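/- **Setting.** Consider $N$ agents $\mathcal V=\{1,\dots,N\}$ with a time-varying undirected topology $\mathcal G(k)=(\mathcal V,\mathcal E(k))$, $k\ge 0$, without self-loops. At each time $k$ some agents may suffer from node failure; a failed agent has no edge in $\mathcal G(k)$. On a probability space let the following random variables, over all $i,j\in\mathcal V$ and $k\ge0$, be mutually independent: $\gamma_i(k)\in\{0,1\}$ with $\mathbb P(\gamma_i(k)=1)=p_i\in(0,1)$ (the choice of one of two time slots for transmission); the fading channels $h_{ij}(k)\sim\mathcal{CN}(0,\Lambda_{ij})$, where $\Lambda_{ij}=\Lambda_{ji}$, and $\Lambda_{ij}>0$ if $(i,j)\in\mathcal E(k)$ for some $k$; and the noises $n_i(k)\sim\mathcal{CN}(0,\sigma_i^2)$. Here $\mathcal{CN}(0,v)$ is the law of a complex random variable whose real and imaginary parts are independent $N(0,v/2)$. Let $\rho>0$, let $u\in\mathbb C$ with $|u|=1$, let $\alpha(k)>0$ be step sizes, and let $x_i(0)\ge 0$ be deterministic initial states. Put $$\Gamma_{ij}(k)=\gamma_i(k)(1-\gamma_j(k))+\gamma_j(k)(1-\gamma_i(k)),\qquad \bar a_{ij}(k)=\begin{cases}\rho\,(p_i(1-p_j)+p_j(1-p_i))\,\Lambda_{ij},&(i,j)\in\mathcal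 E(k),\\0,&(i,j)\notin\mathcal E(k).\end{cases}$$ Agent $i$ receives $$y_i(k)=\sum_{j:(i,j)\in\mathcal E(k)}\Gamma_{ij}(k)\,h_{ij}(k)\sqrt{\rho x_j(k)}\,u+n_i(k),$$ where $\sqrt{\cdot}$ is the principal complex square root (so $\sqrt{\rho x}=i\sqrt{\rho|x|}$ if $x<0$), and the protocol is $$x_i(k+1)=\Big(1-\alpha(k)\sum_{j\in\mathcal V}\bar a_{ij}(k)\Big)x_i(k)+\alpha(k)\big(|y_i(k)|^2-\sigma_i^2\big)$$ if agent $i$ has not failed at time $k$, and $x_i(k+1)=x_i(k)$ if it has. **Theorem.** Assume that 1. $\sum_{k}\alpha(k)=\infty$, $\sum_k\alpha(k)^2<\infty$, and $1-\alpha(k)\sum_{j\in\mathcal V}\bar a_{ij}(k)>0$ for all $i\in\mathcal V$, $k\ge0$; 2. there is an integer $L>0$ such that for every $k\ge 0$ the joint graph $\mathcal G(k)\cup\mathcal G(k+1)\cup\dots\cup\mathcal G(k+L-1)$ is connected; 3. $\alpha(k+1)\le\alpha(k)$ for all $k\ge0$, and $\limsup_{k\to\infty}\alpha(k)/\alpha(k+1)<\infty$.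 Then the system achieves almost sure consensus: there is a real random variable $x^*$ such that for every $i\in\mathcal V$, $\lim_{k\to\infty}x_i(k)=x^*$ almost surely. -/

import Mathlib

open MeasureTheory ProbabilityTheory Filter Topology
open scoped NNReal

namespace OverTheAir

/-- The circularly symmetric complex Gaussian law `CN(0, v)`: the real and the imaginary part are
independent real Gaussians with mean `0` and variance `v / 2` (a Dirac mass at `0` if `v = 0`). -/
noncomputable def complexGaussian (v : ℝ≥0) : Measure ℂ :=
  ((gaussianReal 0 (v / 2)).prod (gaussianReal 0 (v / 2))).map
    (fun z : ℝ × ℝ => (⟨z.1, z.2⟩ : ℂ))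

/-- The deterministic parameters of the multi-agent system with `N` agents, a time-varying
undirected topology and half-duplex non-coherent over-the-air aggregation. -/
structure System (N : ℕ) where
  /-- `p i` is the probability that agent `i` transmits in the first slot -/
  p : Fin N → ℝ
  p_mem : ∀ i, p i ∈ Set.Ioo (0 : ℝ) 1
  /-- the time-varying undirected network topology `G(k)` -/
  G : ℕ → SimpleGraph (Fin N)
  /-- the agents that suffer from node failure at time `k` -/
  failed : ℕ → Set (Fin N)
  /-- a failed agent cannot communicate with any other agent -/
  not_adj_of_failed : ∀ k, ∀ i ∈ failed k, ∀ j, ¬ (G k).Adj i j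
  /-- `Λ i j` is the variance of the fading channel from agent `j` to agent `i` -/
  Λ : Fin N → Fin N → ℝ≥0
  Λ_symm : ∀ i j, Λ i j = Λ j i
  Λ_pos : ∀ k i j, (G k).Adj i j → 0 < Λ i j
  /-- `σ i ^ 2` is the variance of the receiver noise of agent `i` -/
  σ : Fin N → ℝ≥0
  /-- the transmission coefficient for power control -/
  ρ : ℝ
  ρ_pos : 0 < ρ
  /-- the carrier wave -/
  u : ℂ
  norm_u : ‖u‖ = 1
  /-- the step sizes -/
  α : ℕ → ℝ
  α_pos : ∀ k, 0 < α k
  /-- the initial information states -/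
  x₀ : Fin N → ℝ
  x₀_nonneg : ∀ i, 0 ≤ x₀ i

namespace System

variable {N : ℕ} (S : System N)

open Classical in
/-- The mean weight `ā_ij(k) = ρ (p_i (1 - p_j) + p_j (1 - p_i)) Λ_ij` if `(i, j)` is an edge of
`G(k)`, and `0` otherwise. -/
noncomputable def abar (k : ℕ) (i j : Fin N) : ℝ :=
  if (S.G k).Adj i j then
    S.ρ * (S.p i * (1 - S.p j) + S.p j * (1 - S.p i)) * (S.Λ i j : ℝ)
  else 0

/-- Step size conditions: `∑ α(k) = ∞`, `∑ α(k)² < ∞`, and `1 - α(k) ∑_j ā_ij(k) > 0`. -/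
structure StepSize : Prop where
  sum_eq_top : Tendsto (fun n => ∑ k ∈ Finset.range n, S.α k) atTop atTop
  summable_sq : Summable (fun k => S.α k ^ 2)
  weight_pos : ∀ i k, 0 < 1 - S.α k * ∑ j, S.abar k i j

/-- `L`-connectivity: for some `L > 0`, every joint graph
`G(k) ∪ G(k+1) ∪ ⋯ ∪ G(k+L-1)` is connected. -/
def JointlyConnected : Prop :=
  ∃ L : ℕ, 0 < L ∧ ∀ k : ℕ, (⨆ t ∈ Finset.Ico k (k + L), S.G t).Connected

/-- Regularity of the step sizes: `α` is nonincreasing and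
`limsup α(k) / α(k+1) < ∞`. -/
structure StepSizeRegular : Prop where
  le_succ : ∀ k, S.α (k + 1) ≤ S.α k
  limsup_lt_top : IsBoundedUnder (· ≤ ·) atTop (fun k => S.α k / S.α (k + 1))

/-- The signal `√(ρ x) u` sent by an agent in state `x`. The square root is the complex principal
one: the usual root for `x ≥ 0`, and `i √(ρ |x|)` for `x < 0`, so the sent power is `ρ |x|`. -/
noncomputable def signal (x : ℝ) : ℂ :=
  Complex.sqrt ((S.ρ * x : ℝ) : ℂ) * S.u

end System

/-- The random inputs of the system on the probability space `(Ω, μ)`: the slot choices `γ`, the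
fading channels `h` and the receiver noises `n`, all mutually independent. -/
structure Inputs {N : ℕ} (S : System N) {Ω : Type*} [MeasurableSpace Ω] (μ : Measure Ω) where
  /-- `γ k i` is `1` if agent `i` transmits in the first slot at time `k`, and `0` if it transmits
  in the second one -/
  γ : ℕ → Fin N → Ω → ℝ
  /-- `h k i j` is the channel from the transmit antenna of `j` to the receive antenna of `i` -/
  h : ℕ → Fin N → Fin N → Ω → ℂ
  /-- `n k i` is the receiver noise of agent `i` at time `k` -/
  n : ℕ → Fin N → Ω → ℂ
  measurable_γ : ∀ k i, Measurable (γ k i)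
  measurable_h : ∀ k i j, Measurable (h k i j)
  measurable_n : ∀ k i, Measurable (n k i)
  γ_zero_or_one : ∀ k i ω, γ k i ω = 0 ∨ γ k i ω = 1
  γ_law : ∀ k i, μ {ω | γ k i ω = 1} = ENNReal.ofReal (S.p i)
  h_law : ∀ k i j, HasLaw (h k i j) (complexGaussian (S.Λ i j)) μ
  n_law : ∀ k i, HasLaw (n k i) (complexGaussian (S.σ i ^ 2)) μ
  /-- joint mutual independence of the whole family (`γ` is read as complex-valued) -/
  indep : iIndepFun
    (Sum.elim (fun (s : ℕ × Fin N) (ω : Ω) => (γ s.1 s.2 ω : ℂ))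
      (Sum.elim (fun (s : ℕ × Fin N × Fin N) (ω : Ω) => h s.1 s.2.1 s.2.2 ω)
        (fun (s : ℕ × Fin N) (ω : Ω) => n s.1 s.2 ω))) μ

namespace Inputs

variable {N : ℕ} {S : System N} {Ω : Type*} [MeasurableSpace Ω] {μ : Measure Ω}
  (I : Inputs S μ)

/-- `Γ_ij(k) = γ_i(k) (1 - γ_j(k)) + γ_j(k) (1 - γ_i(k))`, which is `1` if `i` and `j` choose
different slots at time `k`, and `0` otherwise. -/
def Γ (k : ℕ) (i j : Fin N) (ω : Ω) : ℝ :=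
  I.γ k i ω * (1 - I.γ k j ω) + I.γ k j ω * (1 - I.γ k i ω)

open Classical in
/-- The signal `y_i(k) = ∑_{j ∈ Ñ_i(k)} Γ_ij(k) h_ij(k) s_j(k) + n_i(k)` received by agent `i` at
time `k`, when the agents are in the states `x`; here `Ñ_i(k)` is the set of the neighbours of `i`
in `G(k)`. -/
noncomputable def received (k : ℕ) (x : Fin N → ℝ) (i : Fin N) (ω : Ω) : ℂ :=
  (∑ j with (S.G k).Adj i j, (I.Γ k i j ω : ℂ) * I.h k i j ω * S.signal (x j)) + I.n k i ω

open Classical in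
/-- The information states `x_i(k)` under the consensus protocol
`x_i(k+1) = (1 - α(k) ∑_j ā_ij(k)) x_i(k) + α(k) (|y_i(k)|² - σ_i²)`;
an agent that suffers from node failure at time `k` keeps its state. -/
noncomputable def state : ℕ → Ω → Fin N → ℝ
  | 0, _ => S.x₀
  | k + 1, ω => fun i =>
      if i ∈ S.failed k then state k ω i
      else (1 - S.α k * ∑ j, S.abar k i j) * state k ω i
        + S.α k * (‖I.received k (state k ω) i ω‖ ^ 2 - (S.σ i : ℝ) ^ 2)

/-- Almost sure consensus: there is a random variable `x*` such that `x_i(k) → x*` almost surely,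
for every agent `i`. -/
def AlmostSureConsensus : Prop :=
  ∃ xstar : Ω → ℝ, Measurable xstar ∧
    ∀ i : Fin N, ∀ᵐ ω ∂μ, Tendsto (fun k => I.state k ω i) atTop (𝓝 (xstar ω))

end Inputs

end OverTheAir

namespace OverTheAir

/-!
Given the past, `|y_i(k)|²` has mean `σ_i² + ∑ j, a_ij(k) |x_j(k)|`, because agent `j` transmits
with power `ρ |x_j(k)|`. The protocol therefore reads
`x(k+1) = x(k) - α(k) Δ(k) x(k) + α(k) ξ(k) + d(k)`, where `Δ(k)` is the graph Laplacian,
`d(k) ≥ 0` is caused by negative states only, and `ξ(k)` is a martingale difference whose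
conditional second moment is `O(1 + |x(k)|²)`. By Jensen's inequality the conditional mean of
`x(k+1)` is no longer than `x(k)`, so Gronwall's inequality and `∑ α(k)² < ∞` bound the second
moments of the states. Hence `∑ α(k) ξ(k)` is an `L²`-bounded martingale and converges almost
surely. The drift `d(k)` is exactly what increases the mean of the total state, which is bounded,
so `∑ d(k)` converges almost surely too.

What remains is deterministic: `x(k+1) = x(k) - α(k) Δ(k) x(k) + e(k)` with `∑ e(k)` convergent.
Adding the tail `r(k)` of the series to `x(k)` replaces `e(k)` by `α(k) Δ(k) r(k)`, where
`r(k) → 0`, and makes the average of the states constant. Over a window of `L` steps the Poincaré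
inequality of the connected joint graph contracts the deviation from the average by a factor
`1 - c α(k)`; the condition on `α(k) / α(k+1)` makes the step sizes within a window comparable.
Since `∑ α(k) = ∞`, the deviation tends to zero.
-/

section Recursions

lemma tendsto_zero_of_le_one_sub_mul {v a : ℕ → ℝ} (hv : ∀ m, 0 ≤ v m)
    (ha : ∀ᶠ m in atTop, a m ≤ 1)
    (hsum : Tendsto (fun n => ∑ m ∈ Finset.range n, a m) atTop atTop)
    (hrec : ∀ᶠ m in atTop, v (m + 1) ≤ (1 - a m) * v m) :
    Tendsto v atTop (𝓝 0) := by
  obtain ⟨m₀, hm₀⟩ := eventually_atTop.1 (ha.and hrec)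
  have hbound : ∀ n ≥ m₀, v n ≤ v m₀ * Real.exp (-∑ m ∈ Finset.Ico m₀ n, a m) := by
    intro n hn
    have hprod : ∏ m ∈ Finset.Ico m₀ n, (1 - a m) ≤ ∏ m ∈ Finset.Ico m₀ n, Real.exp (-a m) :=
      Finset.prod_le_prod
        (fun m hm => sub_nonneg.2 (hm₀ m (Finset.mem_Ico.1 hm).1).1)
        (fun m _ => Real.one_sub_le_exp_neg (a m))
    rw [← Finset.sum_neg_distrib, Real.exp_sum]
    have hgronwall := discrete_gronwall_prod_general (u := v) (c := fun m => 1 - a m)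
      (b := fun _ => 0) (fun m hm => by simpa using (hm₀ m hm).2)
      (fun m hm => sub_nonneg.2 (hm₀ m hm).1) hn
    simp only [zero_mul, Finset.sum_const_zero, add_zero] at hgronwall
    exact hgronwall.trans (mul_le_mul_of_nonneg_left hprod (hv m₀))
  have hsum' : Tendsto (fun n => ∑ m ∈ Finset.Ico m₀ n, a m) atTop atTop := by
    refine (tendsto_atTop_add_const_right _ (-∑ m ∈ Finset.range m₀, a m) hsum).congr' ?_
    filter_upwards [eventually_ge_atTop m₀] with n hn
    rw [Finset.sum_Ico_eq_sub _ hn, sub_eq_add_neg]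
  have hexp := (Real.tendsto_exp_neg_atTop_nhds_zero.comp hsum').const_mul (v m₀)
  rw [mul_zero] at hexp
  exact squeeze_zero' (.of_forall hv) (eventually_atTop.2 ⟨m₀, hbound⟩) hexp

lemma tendsto_zero_of_le_one_sub_mul_add {v a ε : ℕ → ℝ} (hv : ∀ m, 0 ≤ v m)
    (ha : ∀ᶠ m in atTop, a m ∈ Set.Icc (0 : ℝ) 1)
    (hsum : Tendsto (fun n => ∑ m ∈ Finset.range n, a m) atTop atTop)
    (hε : Tendsto ε atTop (𝓝 0))
    (hrec : ∀ᶠ m in atTop, v (m + 1) ≤ (1 - a m) * v m + a m * ε m) :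
    Tendsto v atTop (𝓝 0) := by
  -- As soon as `ε ≤ δ`, the excess of `v` over `δ` obeys the unforced recursion.
  have hexcess (δ : ℝ) (hδ : 0 < δ) : Tendsto (fun m => max (v m - δ) 0) atTop (𝓝 0) := by
    refine tendsto_zero_of_le_one_sub_mul (fun m => le_max_right _ _) (ha.mono fun m h => h.2)
      hsum ?_
    filter_upwards [ha, hrec, hε.eventually_lt_const hδ] with m ⟨ha₀, ha₁⟩ hrec hε
    have hmono := mul_le_mul_of_nonneg_left (le_max_left (v m - δ) 0) (sub_nonneg.2 ha₁)
    refine max_le ?_ (mul_nonneg (sub_nonneg.2 ha₁) (le_max_right _ _))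
    nlinarith [mul_le_mul_of_nonneg_left hε.le ha₀]
  refine tendsto_order.2 ⟨fun b hb => .of_forall fun m => hb.trans_le (hv m), fun b hb => ?_⟩
  filter_upwards [(hexcess (b / 2) (half_pos hb)).eventually_lt_const (half_pos hb)] with m hm
  linarith [le_max_left (v m - b / 2) 0]

lemma tendsto_sum_mul_atTop {α : ℕ → ℝ} (hanti : Antitone α) {L : ℕ} (hL : 0 < L)
    (hsum : Tendsto (fun n => ∑ k ∈ Finset.range n, α k) atTop atTop) :
    Tendsto (fun n => ∑ m ∈ Finset.range n, α (m * L)) atTop atTop := by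
  have hblock : ∀ n, ∑ k ∈ Finset.range (n * L), α k ≤ L * ∑ m ∈ Finset.range n, α (m * L) := by
    intro n
    induction n with
    | zero => simp
    | succ n ih =>
      rw [Nat.succ_mul, Finset.sum_range_add, Finset.sum_range_succ, mul_add]
      refine add_le_add ih ?_
      calc ∑ x ∈ Finset.range L, α (n * L + x) ≤ ∑ _x ∈ Finset.range L, α (n * L) :=
            Finset.sum_le_sum fun x _ => hanti (Nat.le_add_right _ _)
        _ = L * α (n * L) := by simp
  have hblocks : Tendsto (fun n => ∑ k ∈ Finset.range (n * L), α k) atTop atTop :=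
    hsum.comp (tendsto_id.atTop_mul_const' hL)
  exact (tendsto_const_mul_atTop_of_pos (Nat.cast_pos.2 hL)).1 (tendsto_atTop_mono hblock hblocks)

lemma exists_eventually_mul_le_of_isBoundedUnder_div {α : ℕ → ℝ} (hpos : ∀ k, 0 < α k)
    (hbdd : IsBoundedUnder (· ≤ ·) atTop (fun k => α k / α (k + 1))) (L : ℕ) :
    ∃ κ > 0, ∀ᶠ s in atTop, ∀ j < L, κ * α s ≤ α (s + j) := by
  obtain ⟨B, hB⟩ := hbdd
  obtain ⟨s₀, hs₀⟩ := eventually_atTop.1 (eventually_map.1 hB)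
  set C := max B 1
  have hC : 0 < C := zero_lt_one.trans_le (le_max_right _ _)
  have hpow : ∀ s ≥ s₀, ∀ j, α s ≤ C ^ j * α (s + j) := by
    intro s hs j
    induction j with
    | zero => simp
    | succ j ih =>
      have hstep : α (s + j) ≤ C * α (s + j + 1) :=
        ((div_le_iff₀ (hpos _)).1 (hs₀ (s + j) (by lia))).trans
          (mul_le_mul_of_nonneg_right (le_max_left _ _) (hpos _).le)
      rw [pow_succ, mul_assoc, ← add_assoc]
      exact ih.trans (mul_le_mul_of_nonneg_left hstep (pow_nonneg hC.le j))
  refine ⟨(C ^ L)⁻¹, inv_pos.2 (pow_pos hC L), eventually_atTop.2 ⟨s₀, fun s hs j hj => ?_⟩⟩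
  rw [inv_mul_le_iff₀ (pow_pos hC L)]
  exact (hpow s hs j).trans (mul_le_mul_of_nonneg_right
    (pow_le_pow_right₀ (le_max_right _ _) hj.le) (hpos _).le)

end Recursions

lemma sum_mul_norm_le_of_antitone {E : Type*} [SeminormedAddCommGroup E] {α : ℕ → ℝ}
    (hα : ∀ k, 0 ≤ α k) (hanti : Antitone α) (e : ℕ → E) (s : ℕ) {n L : ℕ} (hn : n ≤ L) :
    ∑ j ∈ Finset.range n, α (s + j) * ‖e (s + j)‖
      ≤ α s * ∑ j ∈ Finset.range L, ‖e (s + j)‖ := by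
  rw [Finset.mul_sum]
  calc ∑ j ∈ Finset.range n, α (s + j) * ‖e (s + j)‖
      ≤ ∑ j ∈ Finset.range n, α s * ‖e (s + j)‖ := by
        gcongr with j
        exact hanti (Nat.le_add_right s j)
    _ ≤ ∑ j ∈ Finset.range L, α s * ‖e (s + j)‖ :=
        Finset.sum_le_sum_of_subset_of_nonneg (Finset.range_mono hn) fun j _ _ =>
          mul_nonneg (hα s) (norm_nonneg _)

section GradientSteps

variable {E : Type*} [NormedAddCommGroup E] [InnerProductSpace ℝ E]

/-- Linear cocoercivity `‖A v‖² ≤ K ⟪v, A v⟫`. For a symmetric `A` and `K > 0` this says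
`0 ≤ A ≤ K`, but symmetry is not assumed. -/
def IsCocoercive (K : ℝ) (A : E →ₗ[ℝ] E) : Prop :=
  ∀ v, ‖A v‖ ^ 2 ≤ K * inner ℝ v (A v)

/-- The trajectory `y (k + 1) = y k - α k • A k (y k)` started at `v`. -/
def orbit (A : ℕ → E →ₗ[ℝ] E) (α : ℕ → ℝ) (v : E) : ℕ → E
  | 0 => v
  | k + 1 => orbit A α v k - α k • A k (orbit A α v k)

namespace IsCocoercive

variable {K : ℝ} {A : E →ₗ[ℝ] E}

lemma inner_nonneg (hA : IsCocoercive K A) (hK : 0 < K) (v : E) : 0 ≤ inner ℝ v (A v) :=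
  nonneg_of_mul_nonneg_right ((sq_nonneg _).trans (hA v)) hK

lemma norm_apply_le (hA : IsCocoercive K A) (hK : 0 < K) (v : E) : ‖A v‖ ≤ K * ‖v‖ := by
  have hsq : ‖A v‖ * ‖A v‖ ≤ K * ‖v‖ * ‖A v‖ := by
    calc ‖A v‖ * ‖A v‖ = ‖A v‖ ^ 2 := (sq _).symm
      _ ≤ K * inner ℝ v (A v) := hA v
      _ ≤ K * (‖v‖ * ‖A v‖) := mul_le_mul_of_nonneg_left (real_inner_le_norm _ _) hK.le
      _ = K * ‖v‖ * ‖A v‖ := (mul_assoc _ _ _).symm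
  rcases (norm_nonneg (A v)).eq_or_lt with h | h
  · rw [← h]
    positivity
  · exact le_of_mul_le_mul_right hsq h

lemma inner_le (hA : IsCocoercive K A) (hK : 0 < K) (v : E) :
    inner ℝ v (A v) ≤ K * ‖v‖ ^ 2 := by
  calc inner ℝ v (A v) ≤ ‖v‖ * ‖A v‖ := real_inner_le_norm _ _
    _ ≤ ‖v‖ * (K * ‖v‖) := mul_le_mul_of_nonneg_left (hA.norm_apply_le hK v) (norm_nonneg v)
    _ = K * ‖v‖ ^ 2 := by ring

lemma inner_add_le (hA : IsCocoercive K A) (hK : 0 < K) (v w : E) :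
    inner ℝ (v + w) (A (v + w)) ≤ 2 * inner ℝ v (A v) + 2 * inner ℝ w (A w) := by
  have hparallelogram : inner ℝ (v + w) (A (v + w)) + inner ℝ (v - w) (A (v - w)) =
      2 * inner ℝ v (A v) + 2 * inner ℝ w (A w) := by
    simp only [map_add, map_sub, inner_add_left, inner_add_right, inner_sub_left, inner_sub_right]
    ring
  linarith [hA.inner_nonneg hK (v - w)]

lemma norm_sub_smul_sq_le (hA : IsCocoercive K A) {a : ℝ} (ha : 0 ≤ a) (haK : a * K ≤ 1)
    (hK : 0 < K) (v : E) : ‖v - a • A v‖ ^ 2 ≤ ‖v‖ ^ 2 - a * inner ℝ v (A v) := by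
  have hq := hA.inner_nonneg hK v
  have hsq : a ^ 2 * ‖A v‖ ^ 2 ≤ a * inner ℝ v (A v) := by
    calc a ^ 2 * ‖A v‖ ^ 2 ≤ a ^ 2 * (K * inner ℝ v (A v)) :=
          mul_le_mul_of_nonneg_left (hA v) (sq_nonneg a)
      _ = a * K * (a * inner ℝ v (A v)) := by ring
      _ ≤ a * inner ℝ v (A v) := mul_le_of_le_one_left (mul_nonneg ha hq) haK
  rw [norm_sub_sq_real, real_inner_smul_right, norm_smul, mul_pow, Real.norm_eq_abs, sq_abs]
  linarith

lemma norm_sub_smul_le (hA : IsCocoercive K A) {a : ℝ} (ha : 0 ≤ a) (haK : a * K ≤ 1)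
    (hK : 0 < K) (v : E) : ‖v - a • A v‖ ≤ ‖v‖ := by
  refine le_of_sq_le_sq ?_ (norm_nonneg v)
  linarith [hA.norm_sub_smul_sq_le ha haK hK v, mul_nonneg ha (hA.inner_nonneg hK v)]

end IsCocoercive

variable {K : ℝ} {A : ℕ → E →ₗ[ℝ] E} {α : ℕ → ℝ}

lemma norm_orbit_sq_add_sum_le (hA : ∀ k, IsCocoercive K (A k)) (hK : 0 < K)
    (hα : ∀ k, 0 ≤ α k) (hαK : ∀ k, α k * K ≤ 1) (v : E) (n : ℕ) :
    ‖orbit A α v n‖ ^ 2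
      + ∑ k ∈ Finset.range n, α k * inner ℝ (orbit A α v k) (A k (orbit A α v k)) ≤ ‖v‖ ^ 2 := by
  induction n with
  | zero => simp [orbit]
  | succ n ih =>
    have hstep := (hA n).norm_sub_smul_sq_le (hα n) (hαK n) hK (orbit A α v n)
    rw [Finset.sum_range_succ, orbit]
    linarith

lemma norm_orbit_sub_sq_le (hA : ∀ k, IsCocoercive K (A k)) {a : ℝ}
    (hα : ∀ k, 0 ≤ α k) (hαa : ∀ k, α k ≤ a) (v : E) (n : ℕ) :
    ‖orbit A α v n - v‖ ^ 2 ≤ n * (K * a *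
      ∑ k ∈ Finset.range n, α k * inner ℝ (orbit A α v k) (A k (orbit A α v k))) := by
  have hsum : orbit A α v n - v = -∑ k ∈ Finset.range n, α k • A k (orbit A α v k) := by
    induction n with
    | zero => simp [orbit]
    | succ n ih => rw [Finset.sum_range_succ, neg_add, ← ih, orbit]; abel
  have hterm : ∀ k, ‖α k • A k (orbit A α v k)‖ ^ 2
      ≤ K * a * (α k * inner ℝ (orbit A α v k) (A k (orbit A α v k))) := by
    intro k
    calc ‖α k • A k (orbit A α v k)‖ ^ 2 = α k * α k * ‖A k (orbit A α v k)‖ ^ 2 := by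
          rw [norm_smul, mul_pow, Real.norm_eq_abs, sq_abs, sq]
      _ ≤ a * α k * (K * inner ℝ (orbit A α v k) (A k (orbit A α v k))) :=
          mul_le_mul (mul_le_mul_of_nonneg_right (hαa k) (hα k)) (hA k _) (sq_nonneg _)
            (mul_nonneg ((hα k).trans (hαa k)) (hα k))
      _ = K * a * (α k * inner ℝ (orbit A α v k) (A k (orbit A α v k))) := by ring
  calc ‖orbit A α v n - v‖ ^ 2
      ≤ (∑ k ∈ Finset.range n, ‖α k • A k (orbit A α v k)‖) ^ 2 := by
        rw [hsum, norm_neg]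
        exact pow_le_pow_left₀ (norm_nonneg _) (norm_sum_le _ _) 2
    _ ≤ n * ∑ k ∈ Finset.range n, ‖α k • A k (orbit A α v k)‖ ^ 2 := by
        simpa using sq_sum_le_card_mul_sum_sq (s := Finset.range n)
          (f := fun k => ‖α k • A k (orbit A α v k)‖)
    _ ≤ _ := by
        rw [Finset.mul_sum (a := K * a)]
        exact mul_le_mul_of_nonneg_left (Finset.sum_le_sum fun k _ => hterm k) n.cast_nonneg

lemma norm_orbit_sub_sq_le_of_le (hA : ∀ k, IsCocoercive K (A k)) (hK : 0 < K) {a : ℝ}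
    (hα : ∀ k, 0 ≤ α k) (hαa : ∀ k, α k ≤ a) (v : E) {k n : ℕ} (hkn : k ≤ n) :
    ‖orbit A α v k - v‖ ^ 2 ≤ n * (K * a *
      ∑ l ∈ Finset.range n, α l * inner ℝ (orbit A α v l) (A l (orbit A α v l))) := by
  have ha₀ : 0 ≤ a := (hα 0).trans (hαa 0)
  have hq : ∀ l, 0 ≤ α l * inner ℝ (orbit A α v l) (A l (orbit A α v l)) := fun l =>
    mul_nonneg (hα l) ((hA l).inner_nonneg hK _)
  refine (norm_orbit_sub_sq_le hA hα hαa v k).trans ?_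
  gcongr
  · exact mul_nonneg (mul_nonneg hK.le ha₀) (Finset.sum_nonneg fun l _ => hq l)
  · exact fun l _ _ => hq l

-- `y k - v` has squared size `O(α)` times the energy dissipated along the orbit, so replacing
-- `y k` by `v` in the dissipation costs only a bounded factor.
lemma sum_mul_inner_le_four_mul (hA : ∀ k, IsCocoercive K (A k)) (hK : 0 < K) {a : ℝ}
    (hα : ∀ k, 0 ≤ α k) (hαa : ∀ k, α k ≤ a) {n : ℕ} (ha : n * K * a ≤ 1) (v : E) :
    ∑ k ∈ Finset.range n, α k * inner ℝ v (A k v) ≤ 4 *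
      ∑ k ∈ Finset.range n, α k * inner ℝ (orbit A α v k) (A k (orbit A α v k)) := by
  set y := orbit A α v
  set D := ∑ k ∈ Finset.range n, α k * inner ℝ (y k) (A k (y k))
  have hD : 0 ≤ D := Finset.sum_nonneg fun k _ =>
    mul_nonneg (hα k) ((hA k).inner_nonneg hK _)
  have hdisp : ∀ k ∈ Finset.range n, ‖v - y k‖ ^ 2 ≤ D := by
    intro k hk
    have hk' := norm_orbit_sub_sq_le_of_le hA hK hα hαa v (Finset.mem_range.1 hk).le
    rw [norm_sub_rev]
    calc ‖y k - v‖ ^ 2 ≤ n * K * a * D := by linarith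
      _ ≤ D := mul_le_of_le_one_left hD ha
  have hterm : ∀ k ∈ Finset.range n, α k * inner ℝ v (A k v)
      ≤ 2 * (α k * inner ℝ (y k) (A k (y k))) + 2 * (a * (K * D)) := by
    intro k hk
    have hsplit := (hA k).inner_add_le hK (y k) (v - y k)
    rw [add_sub_cancel] at hsplit
    have hrest : inner ℝ (v - y k) (A k (v - y k)) ≤ K * D :=
      ((hA k).inner_le hK _).trans (mul_le_mul_of_nonneg_left
        (hdisp k hk) hK.le)
    have hrest' : α k * inner ℝ (v - y k) (A k (v - y k)) ≤ a * (K * D) :=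
      (mul_le_mul_of_nonneg_left hrest (hα k)).trans
        (mul_le_mul_of_nonneg_right (hαa k) (mul_nonneg hK.le hD))
    linarith [mul_le_mul_of_nonneg_left hsplit (hα k)]
  calc ∑ k ∈ Finset.range n, α k * inner ℝ v (A k v)
      ≤ ∑ k ∈ Finset.range n, (2 * (α k * inner ℝ (y k) (A k (y k))) + 2 * (a * (K * D))) :=
        Finset.sum_le_sum hterm
    _ = 2 * D + 2 * (n * K * a * D) := by
        rw [Finset.sum_add_distrib, ← Finset.mul_sum, Finset.sum_const, Finset.card_range,
          nsmul_eq_mul]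
        ring
    _ ≤ 4 * D := by linarith [mul_le_of_le_one_left hD ha]

lemma norm_orbit_le_one_sub_mul (hA : ∀ k, IsCocoercive K (A k)) (hK : 0 < K) {a : ℝ}
    (hα : ∀ k, 0 ≤ α k) (hαa : ∀ k, α k ≤ a) (haK : a * K ≤ 1) {n : ℕ} (ha : n * K * a ≤ 1)
    {b : ℝ} (hb : b ≤ 8) {v : E}
    (hv : b * ‖v‖ ^ 2 ≤ ∑ k ∈ Finset.range n, α k * inner ℝ v (A k v)) :
    ‖orbit A α v n‖ ≤ (1 - b / 8) * ‖v‖ := by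
  have henergy := norm_orbit_sq_add_sum_le hA hK hα
    (fun k => (mul_le_mul_of_nonneg_right (hαa k) hK.le).trans haK) v n
  have hdissipation := sum_mul_inner_le_four_mul hA hK hα hαa ha v
  refine le_of_sq_le_sq ?_ (mul_nonneg (by linarith) (norm_nonneg v))
  calc ‖orbit A α v n‖ ^ 2 ≤ (1 - b / 4) * ‖v‖ ^ 2 := by linarith
    _ ≤ (1 - b / 8) ^ 2 * ‖v‖ ^ 2 := by
        gcongr
        linarith [sq_nonneg (b / 8)]
    _ = ((1 - b / 8) * ‖v‖) ^ 2 := (mul_pow _ _ _).symm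

lemma norm_le_add_sum (hA : ∀ k, IsCocoercive K (A k)) (hK : 0 < K)
    (hα : ∀ k, 0 ≤ α k) (hαK : ∀ k, α k * K ≤ 1) {z e : ℕ → E}
    (hz : ∀ k, z (k + 1) = z k - α k • A k (z k) + α k • e k) (n : ℕ) :
    ‖z n‖ ≤ ‖z 0‖ + ∑ k ∈ Finset.range n, α k * ‖e k‖ := by
  induction n with
  | zero => simp
  | succ n ih =>
    calc ‖z (n + 1)‖ ≤ ‖z n - α n • A n (z n)‖ + ‖α n • e n‖ := by
          rw [hz]
          exact norm_add_le _ _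
      _ ≤ ‖z n‖ + α n * ‖e n‖ := by
          rw [norm_smul, Real.norm_of_nonneg (hα n)]
          gcongr
          exact (hA n).norm_sub_smul_le (hα n) (hαK n) hK _
      _ ≤ ‖z 0‖ + ∑ k ∈ Finset.range (n + 1), α k * ‖e k‖ := by
          rw [Finset.sum_range_succ, ← add_assoc]
          gcongr

lemma norm_sub_orbit_le (hA : ∀ k, IsCocoercive K (A k)) (hK : 0 < K)
    (hα : ∀ k, 0 ≤ α k) (hαK : ∀ k, α k * K ≤ 1) {z e : ℕ → E}
    (hz : ∀ k, z (k + 1) = z k - α k • A k (z k) + α k • e k) (n : ℕ) :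
    ‖z n - orbit A α (z 0) n‖ ≤ ∑ k ∈ Finset.range n, α k * ‖e k‖ := by
  have hdiff : ∀ k, z (k + 1) - orbit A α (z 0) (k + 1) = z k - orbit A α (z 0) k
      - α k • A k (z k - orbit A α (z 0) k) + α k • e k := by
    intro k
    rw [hz, orbit, map_sub, smul_sub]
    abel
  simpa [orbit] using
    norm_le_add_sum hA hK hα hαK (z := fun k => z k - orbit A α (z 0) k) hdiff n

section Window

variable {z e : ℕ → E} {L : ℕ} {s : ℕ}

lemma norm_le_add_of_window (hA : ∀ k, IsCocoercive K (A k)) (hK : 0 < K)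
    (hα : ∀ k, 0 ≤ α k) (hanti : Antitone α)
    (hz : ∀ k, z (k + 1) = z k - α k • A k (z k) + α k • e k) (hs : α s * K ≤ 1)
    {n : ℕ} (hn : n ≤ L) :
    ‖z (s + n)‖ ≤ ‖z s‖ + α s * ∑ j ∈ Finset.range L, ‖e (s + j)‖ :=
  (norm_le_add_sum (fun j => hA (s + j)) hK (fun j => hα (s + j))
    (fun j => (mul_le_mul_of_nonneg_right (hanti (Nat.le_add_right s j)) hK.le).trans hs)
    (z := fun j => z (s + j)) (fun j => hz (s + j)) n).trans
    (add_le_add_right (sum_mul_norm_le_of_antitone hα hanti e s hn) _)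

lemma norm_window_le (hA : ∀ k, IsCocoercive K (A k)) (hK : 0 < K)
    (hα : ∀ k, 0 ≤ α k) (hanti : Antitone α)
    (hz : ∀ k, z (k + 1) = z k - α k • A k (z k) + α k • e k) (hs : α s * K ≤ 1)
    (hLs : L * K * α s ≤ 1) {c κ : ℝ} (hκ₀ : 0 ≤ κ)
    (hκ : ∀ j < L, κ * α s ≤ α (s + j)) (hκc : α s * (κ * c) ≤ 8)
    (hexc : c * ‖z s‖ ^ 2 ≤ ∑ j ∈ Finset.range L, inner ℝ (z s) (A (s + j) (z s))) :
    ‖z (s + L)‖ ≤ (1 - α s * (κ * c) / 8) * ‖z s‖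
      + α s * ∑ j ∈ Finset.range L, ‖e (s + j)‖ := by
  have hαs : ∀ j, α (s + j) ≤ α s := fun j => hanti (Nat.le_add_right s j)
  have horbit : ‖orbit (fun j => A (s + j)) (fun j => α (s + j)) (z s) L‖
      ≤ (1 - α s * (κ * c) / 8) * ‖z s‖ := by
    refine norm_orbit_le_one_sub_mul (fun j => hA (s + j)) hK (fun j => hα (s + j)) hαs hs hLs
      hκc ?_
    calc α s * (κ * c) * ‖z s‖ ^ 2 = κ * α s * (c * ‖z s‖ ^ 2) := by ring
      _ ≤ κ * α s * ∑ j ∈ Finset.range L, inner ℝ (z s) (A (s + j) (z s)) :=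
          mul_le_mul_of_nonneg_left hexc (mul_nonneg hκ₀ (hα s))
      _ ≤ ∑ j ∈ Finset.range L, α (s + j) * inner ℝ (z s) (A (s + j) (z s)) := by
          rw [Finset.mul_sum]
          exact Finset.sum_le_sum fun j hj => mul_le_mul_of_nonneg_right
            (hκ j (Finset.mem_range.1 hj)) ((hA (s + j)).inner_nonneg hK _)
  have hdev := (norm_sub_orbit_le (fun j => hA (s + j)) hK (fun j => hα (s + j))
    (fun j => (mul_le_mul_of_nonneg_right (hαs j) hK.le).trans hs)
    (z := fun j => z (s + j)) (fun j => hz (s + j)) L).trans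
    (sum_mul_norm_le_of_antitone hα hanti e s le_rfl)
  have htriangle := norm_le_norm_add_norm_sub' (z (s + L))
    (orbit (fun j => A (s + j)) (fun j => α (s + j)) (z s) L)
  simp only [add_zero] at hdev
  linarith

lemma eventually_mul_le_one (hα₀ : Tendsto α atTop (𝓝 0)) (r : ℝ) :
    ∀ᶠ s in atTop, α s * r ≤ 1 := by
  have hmul := hα₀.mul_const r
  rw [zero_mul] at hmul
  exact hmul.eventually_le_const one_pos

lemma tendsto_zero_of_tendsto_zero_windows (hA : ∀ k, IsCocoercive K (A k)) (hK : 0 < K)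
    (hα : ∀ k, 0 ≤ α k) (hanti : Antitone α) (hα₀ : Tendsto α atTop (𝓝 0))
    (hz : ∀ k, z (k + 1) = z k - α k • A k (z k) + α k • e k)
    (hε : Tendsto (fun s => ∑ j ∈ Finset.range L, ‖e (s + j)‖) atTop (𝓝 0)) (hL : 0 < L)
    (hwindows : Tendsto (fun m => ‖z (m * L)‖) atTop (𝓝 0)) : Tendsto z atTop (𝓝 0) := by
  rw [tendsto_zero_iff_norm_tendsto_zero]
  have hmul : Tendsto (fun m => m * L) atTop atTop := tendsto_id.atTop_mul_const' hL
  have hdiv : Tendsto (fun k => k / L) atTop atTop := Nat.tendsto_div_const_atTop hL.ne'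
  have hbound := (hwindows.comp hdiv).add
    ((hα₀.comp (hmul.comp hdiv)).mul (hε.comp (hmul.comp hdiv)))
  rw [mul_zero, add_zero] at hbound
  refine squeeze_zero' (.of_forall fun k => norm_nonneg _) ?_ hbound
  filter_upwards [(hmul.comp hdiv).eventually (eventually_mul_le_one hα₀ K)] with k hk
  have hk' := norm_le_add_of_window hA hK hα hanti hz hk (Nat.mod_lt k hL).le
  rwa [Function.comp_apply, Nat.div_add_mod'] at hk'

theorem tendsto_zero_of_window_coercive (hA : ∀ k, IsCocoercive K (A k)) (hK : 0 < K)
    (hα : ∀ k, 0 ≤ α k) (hanti : Antitone α) (hα₀ : Tendsto α atTop (𝓝 0))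
    (hsum : Tendsto (fun n => ∑ k ∈ Finset.range n, α k) atTop atTop)
    (hz : ∀ k, z (k + 1) = z k - α k • A k (z k) + α k • e k) (he : Tendsto e atTop (𝓝 0))
    (hL : 0 < L) {c κ : ℝ} (hc : 0 < c) (hκ : 0 < κ)
    (hreg : ∀ᶠ s in atTop, ∀ j < L, κ * α s ≤ α (s + j))
    (hexc : ∀ s, c * ‖z s‖ ^ 2 ≤ ∑ j ∈ Finset.range L, inner ℝ (z s) (A (s + j) (z s))) :
    Tendsto z atTop (𝓝 0) := by
  set b := κ * c / 8
  set ε : ℕ → ℝ := fun s => ∑ j ∈ Finset.range L, ‖e (s + j)‖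
  have hb : 0 < b := div_pos (mul_pos hκ hc) (by norm_num)
  have hε : Tendsto ε atTop (𝓝 0) := by
    simpa using tendsto_finsetSum (Finset.range L) fun j _ =>
      (tendsto_add_atTop_iff_nat j).2 he.norm
  have hsmall := eventually_mul_le_one hα₀
  have hmul : Tendsto (fun m => m * L) atTop atTop := tendsto_id.atTop_mul_const' hL
  refine tendsto_zero_of_tendsto_zero_windows hA hK hα hanti hα₀ hz hε hL ?_
  refine tendsto_zero_of_le_one_sub_mul_add (a := fun m => α (m * L) * b)
    (ε := fun m => ε (m * L) / b) (fun m => norm_nonneg _) ?_ ?_ ?_ ?_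
  · filter_upwards [hmul.eventually (hsmall b)] with m hm
    exact ⟨mul_nonneg (hα _) hb.le, hm⟩
  · simp_rw [← Finset.sum_mul]
    exact (tendsto_sum_mul_atTop hanti hL hsum).atTop_mul_const hb
  · simpa using (hε.comp hmul).div_const b
  · filter_upwards [hmul.eventually (hsmall K), hmul.eventually (hsmall (L * K)),
      hmul.eventually (hsmall b), hmul.eventually hreg] with m h₁ h₂ h₃ h₄
    have hwindow := norm_window_le hA hK hα hanti hz h₁ (by linarith) hκ.le h₄
      (by simp only [b] at h₃; linarith) (hexc (m * L))
    have hforce : α (m * L) * b * (ε (m * L) / b) = α (m * L) * ε (m * L) := by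
      field_simp
    rw [Nat.succ_mul, hforce, mul_div_assoc']
    exact hwindow

end Window

end GradientSteps

section Laplacian

lemma abs_sub_le_length_mul {ι : Type*} {G : SimpleGraph ι} {v : ι → ℝ} {δ : ℝ}
    (h : ∀ i j, G.Adj i j → |v i - v j| ≤ δ) {i j : ι} (p : G.Walk i j) :
    |v i - v j| ≤ p.length * δ := by
  induction p with
  | nil => simp
  | cons hadj q ih =>
    rw [SimpleGraph.Walk.length_cons, Nat.cast_succ, add_one_mul, add_comm]
    exact (abs_sub_le _ _ _).trans (add_le_add (h _ _ hadj) ih)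

variable {ι : Type*} [Fintype ι]

lemma abs_sub_le_card_mul {G : SimpleGraph ι} (hG : G.Connected) {v : ι → ℝ} {δ : ℝ}
    (hδ : 0 ≤ δ) (h : ∀ i j, G.Adj i j → |v i - v j| ≤ δ) (i j : ι) :
    |v i - v j| ≤ Fintype.card ι * δ := by
  classical
  obtain ⟨p⟩ := hG.preconnected i j
  refine (abs_sub_le_length_mul h p.bypass).trans (mul_le_mul_of_nonneg_right ?_ hδ)
  exact Nat.cast_le.2 p.bypass_isPath.length_lt.le

lemma abs_le_of_abs_sub_le_of_sum_eq_zero [Nonempty ι] {v : ι → ℝ} (hv : ∑ i, v i = 0) {δ : ℝ}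
    (h : ∀ i j, |v i - v j| ≤ δ) (i : ι) : |v i| ≤ δ := by
  have hn : (0 : ℝ) < Fintype.card ι := Nat.cast_pos.2 Fintype.card_pos
  have havg : Fintype.card ι * v i = ∑ j, (v i - v j) := by simp [hv]
  refine le_of_mul_le_mul_left ?_ hn
  calc (Fintype.card ι : ℝ) * |v i| = |∑ j, (v i - v j)| := by
        rw [← havg, abs_mul, abs_of_pos hn]
    _ ≤ ∑ j, |v i - v j| := Finset.abs_sum_le_sum_abs _ _
    _ ≤ ∑ _j : ι, δ := Finset.sum_le_sum fun j _ => h i j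
    _ = Fintype.card ι * δ := by simp

/-- The Laplacian of a weighted graph on `ι`, as an operator on Euclidean space; the weight `w i j`
of a pair without an edge is `0`. -/
def laplacian (w : ι → ι → ℝ) : EuclideanSpace ℝ ι →ₗ[ℝ] EuclideanSpace ℝ ι where
  toFun v := WithLp.toLp 2 fun i => ∑ j, w i j * (v i - v j)
  map_add' u v := by
    ext i
    simp only [PiLp.add_apply, ← Finset.sum_add_distrib]
    exact Finset.sum_congr rfl fun j _ => by ring
  map_smul' r v := by
    ext i
    simp only [PiLp.smul_apply, smul_eq_mul, RingHom.id_apply, Finset.mul_sum]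
    exact Finset.sum_congr rfl fun j _ => by ring

lemma laplacian_apply (w : ι → ι → ℝ) (v : EuclideanSpace ℝ ι) (i : ι) :
    laplacian w v i = ∑ j, w i j * (v i - v j) := rfl

lemma laplacian_const (w : ι → ι → ℝ) (c : ℝ) : laplacian w (WithLp.toLp 2 fun _ => c) = 0 := by
  ext i
  simp [laplacian_apply]

lemma laplacian_sum {τ : Type*} (s : Finset τ) (w : τ → ι → ι → ℝ) (v : EuclideanSpace ℝ ι) :
    laplacian (fun i j => ∑ t ∈ s, w t i j) v = ∑ t ∈ s, laplacian (w t) v := by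
  ext i
  simp only [laplacian_apply, WithLp.ofLp_sum, Finset.sum_apply, Finset.sum_mul]
  exact Finset.sum_comm

variable {w : ι → ι → ℝ}

lemma sum_laplacian (hw : ∀ i j, w i j = w j i) (v : EuclideanSpace ℝ ι) :
    ∑ i, laplacian w v i = 0 := by
  have hanti : ∑ i, laplacian w v i = -∑ i, laplacian w v i := by
    simp only [laplacian_apply]
    conv_rhs => rw [Finset.sum_comm, ← Finset.sum_neg_distrib]
    refine Finset.sum_congr rfl fun i _ => ?_
    rw [← Finset.sum_neg_distrib]
    exact Finset.sum_congr rfl fun j _ => by rw [hw i j]; ring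
  linarith

lemma inner_laplacian (hw : ∀ i j, w i j = w j i) (v : EuclideanSpace ℝ ι) :
    inner ℝ v (laplacian w v) = 1 / 2 * ∑ i, ∑ j, w i j * (v i - v j) ^ 2 := by
  have hleft : inner ℝ v (laplacian w v) = ∑ i, ∑ j, w i j * (v i - v j) * v i := by
    simp [PiLp.inner_apply, Finset.sum_mul, laplacian_apply]
  have hright : inner ℝ v (laplacian w v) = -∑ i, ∑ j, w i j * (v i - v j) * v j := by
    rw [hleft, Finset.sum_comm, ← Finset.sum_neg_distrib]
    refine Finset.sum_congr rfl fun i _ => ?_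
    rw [← Finset.sum_neg_distrib]
    exact Finset.sum_congr rfl fun j _ => by rw [hw i j]; ring
  have hdiff : ∑ i, ∑ j, w i j * (v i - v j) ^ 2 =
      ∑ i, ∑ j, w i j * (v i - v j) * v i - ∑ i, ∑ j, w i j * (v i - v j) * v j := by
    simp only [← Finset.sum_sub_distrib]
    exact Finset.sum_congr rfl fun i _ => Finset.sum_congr rfl fun j _ => by ring
  linarith

lemma isCocoercive_laplacian (hw : ∀ i j, w i j = w j i) (hw₀ : ∀ i j, 0 ≤ w i j) {d : ℝ}
    (hd : ∀ i, ∑ j, w i j ≤ d) : IsCocoercive (2 * d) (laplacian w) := by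
  intro v
  have hrow : ∀ i, laplacian w v i ^ 2 ≤ d * ∑ j, w i j * (v i - v j) ^ 2 := by
    intro i
    have hterm : ∀ j ∈ Finset.univ, 0 ≤ w i j * (v i - v j) ^ 2 := fun j _ =>
      mul_nonneg (hw₀ i j) (sq_nonneg _)
    exact (Finset.sum_sq_le_sum_mul_sum_of_sq_le_mul _ (fun j _ => hw₀ i j) hterm
      (fun j _ => by rw [mul_pow, sq (w i j), mul_assoc])).trans
      (mul_le_mul_of_nonneg_right (hd i) (Finset.sum_nonneg hterm))
  calc ‖laplacian w v‖ ^ 2 = ∑ i, laplacian w v i ^ 2 := EuclideanSpace.real_norm_sq_eq _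
    _ ≤ ∑ i, d * ∑ j, w i j * (v i - v j) ^ 2 := Finset.sum_le_sum fun i _ => hrow i
    _ = 2 * d * inner ℝ v (laplacian w v) := by
        rw [inner_laplacian hw, ← Finset.mul_sum]
        ring

lemma mul_sub_sq_le_two_mul_inner_laplacian (hw : ∀ i j, w i j = w j i) (hw₀ : ∀ i j, 0 ≤ w i j)
    (v : EuclideanSpace ℝ ι) (i j : ι) :
    w i j * (v i - v j) ^ 2 ≤ 2 * inner ℝ v (laplacian w v) := by
  have hterm : ∀ i j, 0 ≤ w i j * (v i - v j) ^ 2 := fun i j =>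
    mul_nonneg (hw₀ i j) (sq_nonneg _)
  calc w i j * (v i - v j) ^ 2 ≤ ∑ j, w i j * (v i - v j) ^ 2 :=
        Finset.single_le_sum (f := fun j => w i j * (v i - v j) ^ 2)
          (fun j _ => hterm i j) (Finset.mem_univ j)
    _ ≤ ∑ i, ∑ j, w i j * (v i - v j) ^ 2 :=
        Finset.single_le_sum (f := fun i => ∑ j, w i j * (v i - v j) ^ 2)
          (fun i _ => Finset.sum_nonneg fun j _ => hterm i j) (Finset.mem_univ i)
    _ = 2 * inner ℝ v (laplacian w v) := by rw [inner_laplacian hw]; ring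

lemma poincare_laplacian (hw : ∀ i j, w i j = w j i) (hw₀ : ∀ i j, 0 ≤ w i j)
    {G : SimpleGraph ι} (hG : G.Connected) {m : ℝ} (hm : 0 < m)
    (hadj : ∀ i j, G.Adj i j → m ≤ w i j) {v : EuclideanSpace ℝ ι} (hv : ∑ i, v i = 0) :
    m / (2 * Fintype.card ι ^ 3) * ‖v‖ ^ 2 ≤ inner ℝ v (laplacian w v) := by
  have hι := hG.nonempty
  set q := inner ℝ v (laplacian w v)
  have hedge : ∀ i j, G.Adj i j → m * (v i - v j) ^ 2 ≤ 2 * q := fun i j hij =>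
    (mul_le_mul_of_nonneg_right (hadj i j hij) (sq_nonneg _)).trans
      (mul_sub_sq_le_two_mul_inner_laplacian hw hw₀ v i j)
  have hq : 0 ≤ q := by
    obtain ⟨i⟩ := hG.nonempty
    simpa using mul_sub_sq_le_two_mul_inner_laplacian hw hw₀ v i i
  have hcoord : ∀ i, |v i| ≤ Fintype.card ι * √(2 * q / m) :=
    abs_le_of_abs_sub_le_of_sum_eq_zero hv (abs_sub_le_card_mul hG (Real.sqrt_nonneg _)
      fun i j hij => Real.abs_le_sqrt ((le_div_iff₀' hm).2 (hedge i j hij)))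
  have hnorm : ‖v‖ ^ 2 ≤ Fintype.card ι ^ 3 * (2 * q / m) := by
    calc ‖v‖ ^ 2 = ∑ i, |v i| ^ 2 := by simp [EuclideanSpace.real_norm_sq_eq]
      _ ≤ ∑ _i : ι, (Fintype.card ι * √(2 * q / m)) ^ 2 :=
          Finset.sum_le_sum fun i _ => pow_le_pow_left₀ (abs_nonneg _) (hcoord i) 2
      _ = Fintype.card ι ^ 3 * (2 * q / m) := by
          rw [mul_pow, Real.sq_sqrt (by positivity)]
          simp only [Finset.sum_const, Finset.card_univ, nsmul_eq_mul]
          ring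
  calc m / (2 * Fintype.card ι ^ 3) * ‖v‖ ^ 2
      ≤ m / (2 * Fintype.card ι ^ 3) * (Fintype.card ι ^ 3 * (2 * q / m)) := by gcongr
    _ = q := by field_simp

end Laplacian

section Consensus

variable {ι : Type*} [Fintype ι] {w : ℕ → ι → ι → ℝ} {d m : ℝ} {G : ℕ → SimpleGraph ι} {L : ℕ}

lemma poincare_laplacian_window (hw : ∀ k i j, w k i j = w k j i)
    (hw₀ : ∀ k i j, 0 ≤ w k i j) (hm : 0 < m) (hadj : ∀ k i j, (G k).Adj i j → m ≤ w k i j)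
    {s : ℕ} (hconn : (⨆ t ∈ Finset.Ico s (s + L), G t).Connected)
    {v : EuclideanSpace ℝ ι} (hv : ∑ i, v i = 0) :
    m / (2 * Fintype.card ι ^ 3) * ‖v‖ ^ 2 ≤
      ∑ j ∈ Finset.range L, inner ℝ v (laplacian (w (s + j)) v) := by
  have hjoint : ∀ i j, (⨆ t ∈ Finset.Ico s (s + L), G t).Adj i j →
      m ≤ ∑ t ∈ Finset.Ico s (s + L), w t i j := by
    intro i j hij
    simp only [SimpleGraph.iSup_adj] at hij
    obtain ⟨t, ht, hij⟩ := hij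
    exact (hadj t i j hij).trans (Finset.single_le_sum (fun t _ => hw₀ t i j) ht)
  have hpoincare := poincare_laplacian
    (fun i j => Finset.sum_congr rfl fun t _ => hw t i j)
    (fun i j => Finset.sum_nonneg fun t _ => hw₀ t i j) hconn hm hjoint hv
  rwa [laplacian_sum, inner_sum, Finset.sum_Ico_eq_sum_range, Nat.add_sub_cancel_left] at hpoincare

lemma tendsto_zero_of_jointlyConnected {α : ℕ → ℝ} {z r : ℕ → EuclideanSpace ℝ ι}
    (hw : ∀ k i j, w k i j = w k j i) (hw₀ : ∀ k i j, 0 ≤ w k i j) (hd : 0 < d)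
    (hdeg : ∀ k i, ∑ j, w k i j ≤ d) (hm : 0 < m) (hadj : ∀ k i j, (G k).Adj i j → m ≤ w k i j)
    (hL : 0 < L) (hconn : ∀ k, (⨆ t ∈ Finset.Ico k (k + L), G t).Connected)
    (hα : ∀ k, 0 < α k) (hanti : Antitone α) (hα₀ : Tendsto α atTop (𝓝 0))
    (hsum : Tendsto (fun n => ∑ k ∈ Finset.range n, α k) atTop atTop)
    (hratio : IsBoundedUnder (· ≤ ·) atTop (fun k => α k / α (k + 1)))
    (hz : ∀ k, z (k + 1) = z k - α k • laplacian (w k) (z k) + α k • laplacian (w k) (r k))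
    (hr : Tendsto r atTop (𝓝 0)) (hz₀ : ∑ i, z 0 i = 0) : Tendsto z atTop (𝓝 0) := by
  have hcoco : ∀ k, IsCocoercive (2 * d) (laplacian (w k)) := fun k =>
    isCocoercive_laplacian (hw k) (hw₀ k) (hdeg k)
  have hK : 0 < 2 * d := mul_pos two_pos hd
  have hzsum : ∀ k, ∑ i, z k i = 0 := by
    intro k
    induction k with
    | zero => exact hz₀
    | succ k ih =>
      simp only [hz k, PiLp.add_apply, PiLp.sub_apply, PiLp.smul_apply, smul_eq_mul,
        Finset.sum_add_distrib, Finset.sum_sub_distrib, ← Finset.mul_sum, ih,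
        sum_laplacian (hw k), mul_zero, sub_zero, add_zero]
  have he : Tendsto (fun k => laplacian (w k) (r k)) atTop (𝓝 0) := by
    refine squeeze_zero_norm (fun k => (hcoco k).norm_apply_le hK (r k)) ?_
    simpa using hr.norm.const_mul (2 * d)
  have hn : (0 : ℝ) < Fintype.card ι := by
    have hι := (hconn 0).nonempty
    exact Nat.cast_pos.2 Fintype.card_pos
  obtain ⟨κ, hκ, hreg⟩ := exists_eventually_mul_le_of_isBoundedUnder_div hα hratio L
  exact tendsto_zero_of_window_coercive hcoco hK (fun k => (hα k).le) hanti hα₀ hsum hz he hL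
    (by positivity) hκ hreg fun s =>
      poincare_laplacian_window hw hw₀ hm hadj (hconn s) (hzsum s)

theorem exists_tendsto_const_of_jointlyConnected {α : ℕ → ℝ} {x e : ℕ → EuclideanSpace ℝ ι}
    (hw : ∀ k i j, w k i j = w k j i) (hw₀ : ∀ k i j, 0 ≤ w k i j) (hd : 0 < d)
    (hdeg : ∀ k i, ∑ j, w k i j ≤ d) (hm : 0 < m) (hadj : ∀ k i j, (G k).Adj i j → m ≤ w k i j)
    (hL : 0 < L) (hconn : ∀ k, (⨆ t ∈ Finset.Ico k (k + L), G t).Connected)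
    (hα : ∀ k, 0 < α k) (hanti : Antitone α) (hα₀ : Tendsto α atTop (𝓝 0))
    (hsum : Tendsto (fun n => ∑ k ∈ Finset.range n, α k) atTop atTop)
    (hratio : IsBoundedUnder (· ≤ ·) atTop (fun k => α k / α (k + 1)))
    (hx : ∀ k, x (k + 1) = x k - α k • laplacian (w k) (x k) + e k) {D : EuclideanSpace ℝ ι}
    (he : Tendsto (fun n => ∑ k ∈ Finset.range n, e k) atTop (𝓝 D)) :
    ∃ c : ℝ, Tendsto x atTop (𝓝 (WithLp.toLp 2 fun _ => c)) := by
  -- Adding the tail `r k` of the perturbation series to `x k` turns the perturbation `e k` into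
  -- `α k • laplacian (w k) (r k)`.
  set r : ℕ → EuclideanSpace ℝ ι := fun k => D - ∑ l ∈ Finset.range k, e l
  have hr : Tendsto r atTop (𝓝 0) := by simpa using he.const_sub D
  set c : ℝ := (∑ i, (x 0 i + r 0 i)) / Fintype.card ι
  set C : EuclideanSpace ℝ ι := WithLp.toLp 2 fun _ => c
  have hz : Tendsto (fun k => x k + r k - C) atTop (𝓝 0) := by
    refine tendsto_zero_of_jointlyConnected hw hw₀ hd hdeg hm hadj hL hconn hα hanti hα₀ hsum
      hratio (fun k => ?_) hr ?_
    · simp only [hx k, r, Finset.sum_range_succ, map_sub, map_add, laplacian_const, smul_add,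
        smul_sub, smul_zero, C]
      abel
    · have hn : (Fintype.card ι : ℝ) ≠ 0 := by
        have hι := (hconn 0).nonempty
        exact Nat.cast_ne_zero.2 Fintype.card_ne_zero
      simp [C, c, mul_div_cancel₀, hn]
  refine ⟨c, ?_⟩
  have hxk : ∀ k, x k = x k + r k - C - r k + C := fun k => by abel
  simpa only [sub_zero, zero_add, ← hxk] using (hz.sub hr).add_const C

end Consensus

section Freezing

variable {Ω β γ E : Type*} {m mΩ : MeasurableSpace Ω} [MeasurableSpace β] [MeasurableSpace γ]
  [NormedAddCommGroup E] {μ : Measure Ω} [IsFiniteMeasure μ] {Z : Ω → β} {W : Ω → γ} {F : β × γ → E}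

lemma integrable_comp_prodMk_of_indepFun (hZ : Measurable Z) (hW : Measurable W)
    (hind : IndepFun Z W μ) (hF : StronglyMeasurable F)
    (hint : ∀ z, Integrable (fun ω => F (z, W ω)) μ)
    (hnorm : Integrable (fun ω => ∫ ω', ‖F (Z ω, W ω')‖ ∂μ) μ) :
    Integrable (fun ω => F (Z ω, W ω)) μ := by
  have hslice z : AEStronglyMeasurable (fun w => F (z, w)) (μ.map W) :=
    (hF.comp_measurable measurable_prodMk_left).aestronglyMeasurable
  have hprod : Integrable F ((μ.map Z).prod (μ.map W)) := by
    refine (integrable_prod_iff hF.aestronglyMeasurable).2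
      ⟨ae_of_all _ fun z => (integrable_map_measure (hslice z) hW.aemeasurable).2 (hint z), ?_⟩
    rw [integrable_map_measure hF.norm.integral_prod_right'.aestronglyMeasurable hZ.aemeasurable]
    refine hnorm.congr (ae_of_all _ fun ω => ?_)
    exact (integral_map hW.aemeasurable (hslice (Z ω)).norm).symm
  rw [← hind.map_prod_eq_prod_map_map hZ.aemeasurable hW.aemeasurable] at hprod
  exact hprod.comp_measurable (hZ.prodMk hW)

variable [NormedSpace ℝ E]

lemma integral_comp_prodMk_of_indepFun (hZ : Measurable Z) (hW : Measurable W)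
    (hind : IndepFun Z W μ) (hF : StronglyMeasurable F)
    (hint : Integrable (fun ω => F (Z ω, W ω)) μ) :
    ∫ ω, F (Z ω, W ω) ∂μ = ∫ ω, ∫ ω', F (Z ω, W ω') ∂μ ∂μ := by
  have hZW : Measurable fun ω => (Z ω, W ω) := hZ.prodMk hW
  have hmap := hind.map_prod_eq_prod_map_map hZ.aemeasurable hW.aemeasurable
  have hprod : Integrable F ((μ.map Z).prod (μ.map W)) := by
    rw [← hmap]
    exact (integrable_map_measure hF.aestronglyMeasurable hZW.aemeasurable).2 hint
  calc ∫ ω, F (Z ω, W ω) ∂μ = ∫ q, F q ∂(μ.map Z).prod (μ.map W) := by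
        rw [← hmap, integral_map hZW.aemeasurable hF.aestronglyMeasurable]
    _ = ∫ z, ∫ w, F (z, w) ∂μ.map W ∂μ.map Z := integral_prod _ hprod
    _ = ∫ ω, ∫ w, F (Z ω, w) ∂μ.map W ∂μ :=
        integral_map hZ.aemeasurable hF.integral_prod_right'.aestronglyMeasurable
    _ = ∫ ω, ∫ ω', F (Z ω, W ω') ∂μ ∂μ := by
        congr with ω
        exact integral_map hW.aemeasurable
          (hF.comp_measurable measurable_prodMk_left).aestronglyMeasurable

lemma condExp_comp_prodMk_ae_eq [CompleteSpace E] (hm : m ≤ mΩ)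
    (hZ : Measurable[m] Z) (hW : Measurable W)
    (hind : Indep m (MeasurableSpace.comap W inferInstance) μ) (hF : StronglyMeasurable F)
    (hint : Integrable (fun ω => F (Z ω, W ω)) μ)
    (hint' : Integrable (fun ω => ∫ ω', F (Z ω, W ω') ∂μ) μ) :
    μ[fun ω => F (Z ω, W ω) | m] =ᵐ[μ] fun ω => ∫ ω', F (Z ω, W ω') ∂μ := by
  have hmeas : StronglyMeasurable fun z => ∫ ω', F (z, W ω') ∂μ :=
    StronglyMeasurable.integral_prod_right (f := fun z ω => F (z, W ω))
      (hF.comp_measurable (measurable_id.prodMap hW))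
  refine (ae_eq_condExp_of_forall_setIntegral_eq hm hint (fun s _ _ => hint'.integrableOn)
    (fun s hs _ => ?_) (hmeas.comp_measurable hZ).aestronglyMeasurable).symm
  let Z' : Ω → β × ℝ := fun ω => (Z ω, s.indicator 1 ω)
  have hZ' : Measurable[m] Z' := hZ.prodMk (Measurable.indicator (m := m) measurable_const hs)
  have hind' : IndepFun Z' W μ :=
    (IndepFun_iff_Indep _ _ _).2 (indep_of_indep_of_le_left hind hZ'.comap_le)
  have hindicator (G : Ω → E) : (fun ω => s.indicator (1 : Ω → ℝ) ω • G ω) = s.indicator G := by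
    ext ω
    by_cases hω : ω ∈ s <;> simp [hω]
  have hfreeze := integral_comp_prodMk_of_indepFun (F := fun q => q.1.2 • F (q.1.1, q.2))
    (hZ'.mono hm le_rfl) hW hind' (by fun_prop)
    ((hint.indicator (hm s hs)).congr (.of_eq (hindicator _).symm))
  simp only [Z', integral_smul] at hfreeze
  rw [hindicator, hindicator, integral_indicator (hm s hs), integral_indicator (hm s hs)]
    at hfreeze
  exact hfreeze.symm

end Freezing

section Independence

variable {Ω ι : Type*} {mΩ : MeasurableSpace Ω} {μ : Measure Ω}

lemma indepFun_of_measurable_iSup_comap {β : ι → Type*} [∀ i, MeasurableSpace (β i)]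
    {X : ∀ i, Ω → β i} (hX : ∀ i, Measurable (X i)) (hind : iIndepFun X μ) {s t : Set ι}
    (hst : Disjoint s t) {γ δ : Type*} [MeasurableSpace γ] [MeasurableSpace δ] {f : Ω → γ}
    {g : Ω → δ} (hf : Measurable[⨆ i ∈ s, MeasurableSpace.comap (X i) inferInstance] f)
    (hg : Measurable[⨆ i ∈ t, MeasurableSpace.comap (X i) inferInstance] g) :
    IndepFun f g μ := by
  have hblocks := indep_iSup_of_disjoint (fun i => (hX i).comap_le) hind hst
  exact (IndepFun_iff_Indep _ _ _).2
    (indep_of_indep_of_le_left (indep_of_indep_of_le_right hblocks hg.comap_le) hf.comap_le)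

variable {E : Type*} [NormedAddCommGroup E] [InnerProductSpace ℝ E]

lemma integral_inner_eq_zero_of_indepFun [CompleteSpace E] [MeasurableSpace E] [BorelSpace E]
    {X Y : Ω → E} (hXY : IndepFun X Y μ) (hX : Integrable X μ) (hY : Integrable Y μ)
    (hY₀ : ∫ ω, Y ω ∂μ = 0) : ∫ ω, inner ℝ (X ω) (Y ω) ∂μ = 0 := by
  have hfactor := hXY.integral_bilin hX hY (innerSL ℝ)
  simpa only [hY₀, map_zero] using! hfactor

lemma integrable_inner_of_memLp_two {f g : Ω → E} (hf : MemLp f 2 μ) (hg : MemLp g 2 μ) :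
    Integrable (fun ω => inner ℝ (f ω) (g ω)) μ :=
  (hf.norm.integrable_mul hg.norm).mono' (hf.1.inner hg.1)
    (ae_of_all _ fun _ => norm_inner_le_norm _ _)

lemma integral_norm_add_sq_of_integral_inner_eq_zero {f g : Ω → E} (hf : MemLp f 2 μ)
    (hg : MemLp g 2 μ) (hfg : ∫ ω, inner ℝ (f ω) (g ω) ∂μ = 0) :
    ∫ ω, ‖f ω + g ω‖ ^ 2 ∂μ = ∫ ω, ‖f ω‖ ^ 2 ∂μ + ∫ ω, ‖g ω‖ ^ 2 ∂μ := by
  have hf₂ : Integrable (fun ω => ‖f ω‖ ^ 2) μ := hf.integrable_norm_pow two_ne_zero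
  have hg₂ : Integrable (fun ω => ‖g ω‖ ^ 2) μ := hg.integrable_norm_pow two_ne_zero
  have hcross := (integrable_inner_of_memLp_two hf hg).const_mul 2
  have hsum : Integrable (fun ω => ‖f ω‖ ^ 2 + 2 * inner ℝ (f ω) (g ω)) μ := hf₂.add hcross
  simp_rw [norm_add_sq_real]
  rw [integral_add hsum hg₂, integral_add hf₂ hcross, integral_const_mul, hfg,
    mul_zero, add_zero]

lemma integral_norm_sum_sq_of_pairwise {f : ι → Ω → E} (hf : ∀ i, MemLp (f i) 2 μ)
    (horth : Pairwise fun i j => ∫ ω, inner ℝ (f i ω) (f j ω) ∂μ = 0) (s : Finset ι) :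
    ∫ ω, ‖∑ i ∈ s, f i ω‖ ^ 2 ∂μ = ∑ i ∈ s, ∫ ω, ‖f i ω‖ ^ 2 ∂μ := by
  classical
  induction s using Finset.induction_on with
  | empty => simp
  | insert i s hi ih =>
    have hinner : ∫ ω, inner ℝ (f i ω) (∑ j ∈ s, f j ω) ∂μ = 0 := by
      simp_rw [inner_sum]
      rw [integral_finsetSum s fun j _ => integrable_inner_of_memLp_two (hf i) (hf j)]
      exact Finset.sum_eq_zero fun j hj => horth (ne_of_mem_of_not_mem hj hi).symm
    simp_rw [Finset.sum_insert hi]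
    rw [integral_norm_add_sq_of_integral_inner_eq_zero (hf i)
      (memLp_finsetSum s fun j _ => hf j) hinner, ih]

end Independence

section Martingale

variable {Ω : Type*} {m mΩ : MeasurableSpace Ω} {μ : Measure Ω}

lemma integral_add_sq_of_condExp_eq_zero {f g : Ω → ℝ} (hm : m ≤ mΩ) [SigmaFinite (μ.trim hm)]
    (hf : StronglyMeasurable[m] f) (hf₂ : MemLp f 2 μ) (hg : Integrable g μ) (hg₂ : MemLp g 2 μ)
    (hg₀ : μ[g | m] =ᵐ[μ] 0) :
    ∫ ω, (f ω + g ω) ^ 2 ∂μ = ∫ ω, f ω ^ 2 ∂μ + ∫ ω, g ω ^ 2 ∂μ := by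
  have hpull : μ[g * f | m] =ᵐ[μ] 0 := by
    filter_upwards [condExp_mul_of_stronglyMeasurable_right hf (hg₂.integrable_mul hf₂) hg, hg₀]
      with ω hω hω₀
    rw [hω, Pi.mul_apply, hω₀, Pi.zero_apply, zero_mul]
  have horth : ∫ ω, inner ℝ (f ω) (g ω) ∂μ = 0 :=
    (integral_condExp hm).symm.trans (integral_eq_zero_of_ae hpull)
  simpa only [Real.norm_eq_abs, sq_abs] using
    integral_norm_add_sq_of_integral_inner_eq_zero hf₂ hg₂ horth

lemma integral_abs_le_one_add_integral_sq [IsProbabilityMeasure μ] {f : Ω → ℝ}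
    (hf : MemLp f 2 μ) : ∫ ω, |f ω| ∂μ ≤ 1 + ∫ ω, f ω ^ 2 ∂μ := by
  calc ∫ ω, |f ω| ∂μ ≤ ∫ ω, (1 + f ω ^ 2) ∂μ := by
        refine integral_mono (hf.integrable one_le_two).abs
          ((integrable_const 1).add hf.integrable_sq) fun ω => ?_
        nlinarith [sq_nonneg (|f ω| - 1), sq_abs (f ω), abs_nonneg (f ω)]
    _ = 1 + ∫ ω, f ω ^ 2 ∂μ := by
        rw [integral_add (integrable_const 1) hf.integrable_sq, integral_const, probReal_univ,
          one_smul]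

section IncrementSeries

variable [IsProbabilityMeasure μ] {ℱ : Filtration ℕ mΩ} {X : ℕ → Ω → ℝ}

lemma stronglyMeasurable_sum_increments (hX : ∀ k, StronglyMeasurable[ℱ (k + 1)] (X k)) (n : ℕ) :
    StronglyMeasurable[ℱ n] fun ω => ∑ k ∈ Finset.range n, X k ω :=
  Finset.stronglyMeasurable_fun_sum _ fun k hk =>
    (hX k).mono (ℱ.mono (Finset.mem_range.1 hk))

lemma integral_sum_sq_of_condExp_eq_zero (hX : ∀ k, StronglyMeasurable[ℱ (k + 1)] (X k))
    (hX₂ : ∀ k, MemLp (X k) 2 μ) (hX₀ : ∀ k, μ[X k | ℱ k] =ᵐ[μ] 0) (n : ℕ) :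
    ∫ ω, (∑ k ∈ Finset.range n, X k ω) ^ 2 ∂μ =
      ∑ k ∈ Finset.range n, ∫ ω, X k ω ^ 2 ∂μ := by
  induction n with
  | zero => simp
  | succ n ih =>
    simp_rw [Finset.sum_range_succ]
    rw [integral_add_sq_of_condExp_eq_zero (ℱ.le n) (stronglyMeasurable_sum_increments hX n)
      (memLp_finsetSum _ fun k _ => hX₂ k) ((hX₂ n).integrable one_le_two) (hX₂ n) (hX₀ n), ih]

theorem ae_exists_tendsto_sum_of_condExp_eq_zero
    (hX : ∀ k, StronglyMeasurable[ℱ (k + 1)] (X k)) (hX₂ : ∀ k, MemLp (X k) 2 μ)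
    (hX₀ : ∀ k, μ[X k | ℱ k] =ᵐ[μ] 0) (hsum : Summable fun k => ∫ ω, X k ω ^ 2 ∂μ) :
    ∀ᵐ ω ∂μ, ∃ c, Tendsto (fun n => ∑ k ∈ Finset.range n, X k ω) atTop (𝓝 c) := by
  let M : ℕ → Ω → ℝ := fun n ω => ∑ k ∈ Finset.range n, X k ω
  have hM₂ n : MemLp (M n) 2 μ := memLp_finsetSum _ fun k _ => hX₂ k
  have hM n : Integrable (M n) μ := (hM₂ n).integrable one_le_two
  have hmart : Martingale M ℱ μ := by
    refine martingale_of_condExp_sub_eq_zero_nat (stronglyMeasurable_sum_increments hX) hM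
      fun n => ?_
    have hincr : M (n + 1) - M n = X n := by
      ext ω
      exact sub_eq_of_eq_add' (Finset.sum_range_succ _ _)
    rw [hincr]
    exact hX₀ n
  have hbound n : eLpNorm (M n) 1 μ ≤ (1 + ∑' k, ∫ ω, X k ω ^ 2 ∂μ).toNNReal := by
    rw [eLpNorm_one_eq_lintegral_enorm, ← ofReal_integral_norm_eq_lintegral_enorm (hM n)]
    refine ENNReal.ofReal_le_ofReal ((integral_abs_le_one_add_integral_sq (hM₂ n)).trans ?_)
    rw [integral_sum_sq_of_condExp_eq_zero hX hX₂ hX₀]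
    gcongr
    exact hsum.sum_le_tsum _ fun k _ => integral_nonneg fun ω => sq_nonneg _
  exact hmart.submartingale.exists_ae_tendsto_of_bdd hbound

end IncrementSeries

end Martingale

lemma ae_summable_of_summable_integral {Ω : Type*} {mΩ : MeasurableSpace Ω} {μ : Measure Ω}
    {f : ℕ → Ω → ℝ} (hf : ∀ n, Integrable (f n) μ) (hf₀ : ∀ n ω, 0 ≤ f n ω)
    (hsum : Summable fun n => ∫ ω, f n ω ∂μ) : ∀ᵐ ω ∂μ, Summable fun n => f n ω := by
  have hnorm n : ∫ ω, ‖f n ω‖ ∂μ = ∫ ω, f n ω ∂μ :=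
    integral_congr_ae (ae_of_all _ fun ω => Real.norm_of_nonneg (hf₀ n ω))
  have hfin : ∑' n, eLpNorm (f n) 1 μ ≠ ⊤ := by
    simp_rw [eLpNorm_one_eq_lintegral_enorm, ← ofReal_integral_norm_eq_lintegral_enorm (hf _),
      hnorm, ← ENNReal.ofReal_tsum_of_nonneg (fun n => integral_nonneg (hf₀ n)) hsum]
    exact ENNReal.ofReal_ne_top
  filter_upwards [summable_norm_of_tsum_eLpNorm_ne_top le_rfl (fun n => (hf n).1) hfin] with ω hω
  exact hω.of_norm

section ComplexGaussian

lemma measurable_complex_mk : Measurable (fun z : ℝ × ℝ => (⟨z.1, z.2⟩ : ℂ)) := by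
  simp_rw [Complex.mk_eq_add_mul_I]
  fun_prop

lemma memLp_id_complexGaussian (v : ℝ≥0) {p : ENNReal} (hp : p ≠ ⊤) :
    MemLp (fun z => z) p (complexGaussian v) := by
  refine (memLp_map_measure_iff measurable_id.aestronglyMeasurable
    measurable_complex_mk.aemeasurable).2 ?_
  have hreal : MemLp (fun x : ℝ => x) p (gaussianReal 0 (v / 2)) := memLp_id_gaussianReal' p hp
  have hsum := (hreal.comp_fst (gaussianReal 0 (v / 2))).ofReal (K := ℂ) |>.add
    (((hreal.comp_snd (gaussianReal 0 (v / 2))).ofReal (K := ℂ)).mul_const Complex.I)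
  exact hsum.ae_eq (ae_of_all _ fun z => (Complex.mk_eq_add_mul_I _ _).symm)

lemma integral_id_complexGaussian (v : ℝ≥0) : ∫ z, z ∂complexGaussian v = 0 := by
  have hint : Integrable (fun x : ℝ => x) (gaussianReal 0 (v / 2)) :=
    (memLp_id_gaussianReal' 1 ENNReal.one_ne_top).integrable le_rfl
  rw [complexGaussian, integral_map measurable_complex_mk.aemeasurable (by fun_prop)]
  simp_rw [Complex.mk_eq_add_mul_I]
  rw [integral_add (hint.comp_fst _).ofReal ((hint.comp_snd _).ofReal.mul_const _),
    integral_fun_fst (fun x : ℝ => (x : ℂ)), integral_fun_snd (fun x : ℝ => (x : ℂ) * Complex.I),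
    integral_mul_const, integral_complex_ofReal, integral_id_gaussianReal]
  simp

lemma integral_sq_gaussianReal (v : ℝ≥0) : ∫ x, x ^ 2 ∂gaussianReal 0 v = v := by
  have hvar := variance_eq_sub (memLp_id_gaussianReal' (μ := 0) (v := v) 2 ENNReal.ofNat_ne_top)
  rw [variance_id_gaussianReal] at hvar
  simpa [integral_id_gaussianReal] using hvar.symm

lemma integral_norm_sq_complexGaussian (v : ℝ≥0) : ∫ z, ‖z‖ ^ 2 ∂complexGaussian v = v := by
  have hsq : Integrable (fun x : ℝ => x ^ 2) (gaussianReal 0 (v / 2)) :=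
    (memLp_id_gaussianReal' 2 ENNReal.ofNat_ne_top).integrable_sq
  have hnorm (z : ℝ × ℝ) : ‖(⟨z.1, z.2⟩ : ℂ)‖ ^ 2 = z.1 ^ 2 + z.2 ^ 2 := by
    rw [Complex.sq_norm, Complex.normSq_mk, sq, sq]
  rw [complexGaussian, integral_map measurable_complex_mk.aemeasurable (by fun_prop)]
  simp_rw [hnorm]
  rw [integral_add (hsq.comp_fst _) (hsq.comp_snd _), integral_fun_fst (fun x : ℝ => x ^ 2),
    integral_fun_snd (fun x : ℝ => x ^ 2), integral_sq_gaussianReal]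
  simp

end ComplexGaussian

namespace System

variable {N : ℕ} (S : System N)

lemma measurable_signal : Measurable S.signal := by
  unfold signal Complex.sqrt
  fun_prop

lemma norm_signal_sq (x : ℝ) : ‖S.signal x‖ ^ 2 = S.ρ * |x| := by
  rw [signal, norm_mul, S.norm_u, mul_one, ← norm_pow, Complex.sqrt, ← Complex.cpow_nat_mul]
  simp [abs_of_pos S.ρ_pos]

lemma norm_signal_pow_four (x : ℝ) : ‖S.signal x‖ ^ 4 = S.ρ ^ 2 * x ^ 2 := by
  rw [pow_mul ‖S.signal x‖ 2 2, S.norm_signal_sq, mul_pow, sq_abs]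

lemma abar_symm (k : ℕ) (i j : Fin N) : S.abar k i j = S.abar k j i := by
  unfold abar
  rw [(S.G k).adj_comm i j, S.Λ_symm i j, add_comm (S.p i * _)]

lemma abar_of_not_adj {k : ℕ} {i j : Fin N} (hij : ¬ (S.G k).Adj i j) : S.abar k i j = 0 :=
  if_neg hij

lemma abar_of_adj {k : ℕ} {i j : Fin N} (hij : (S.G k).Adj i j) :
    S.abar k i j = S.ρ * (S.p i * (1 - S.p j) + S.p j * (1 - S.p i)) * S.Λ i j :=
  if_pos hij

lemma slot_ne_prob_pos (i j : Fin N) : 0 < S.p i * (1 - S.p j) + S.p j * (1 - S.p i) := by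
  obtain ⟨hi₀, hi₁⟩ := S.p_mem i
  obtain ⟨hj₀, hj₁⟩ := S.p_mem j
  exact add_pos (mul_pos hi₀ (sub_pos.2 hj₁)) (mul_pos hj₀ (sub_pos.2 hi₁))

lemma abar_pos {k : ℕ} {i j : Fin N} (hij : (S.G k).Adj i j) : 0 < S.abar k i j := by
  rw [S.abar_of_adj hij]
  exact mul_pos (mul_pos S.ρ_pos (S.slot_ne_prob_pos i j)) (S.Λ_pos k i j hij)

lemma abar_nonneg (k : ℕ) (i j : Fin N) : 0 ≤ S.abar k i j := by
  by_cases hij : (S.G k).Adj i j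
  · exact (S.abar_pos hij).le
  · exact (S.abar_of_not_adj hij).ge

lemma abar_of_failed {k : ℕ} {i : Fin N} (hi : i ∈ S.failed k) (j : Fin N) :
    S.abar k i j = 0 :=
  S.abar_of_not_adj (S.not_adj_of_failed k i hi j)

end System

section InputSigmaAlgebras

/-- The indices of the random inputs: slot choices `γ_i(k)`, channels `h_ij(k)`, and noises
`n_i(k)`, in this order and each with its time first. -/
abbrev InputIndex (N : ℕ) : Type := (ℕ × Fin N) ⊕ ((ℕ × Fin N × Fin N) ⊕ (ℕ × Fin N))

namespace Inputs

variable {N : ℕ} {S : System N} {Ω : Type*} [mΩ : MeasurableSpace Ω] {μ : Measure Ω}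
  (I : Inputs S μ)

/-- All the inputs as one family of complex random variables, to which the independence assumption
refers. -/
def family : InputIndex N → Ω → ℂ :=
  Sum.elim (fun (s : ℕ × Fin N) (ω : Ω) => (I.γ s.1 s.2 ω : ℂ))
    (Sum.elim (fun (s : ℕ × Fin N × Fin N) (ω : Ω) => I.h s.1 s.2.1 s.2.2 ω)
      (fun (s : ℕ × Fin N) (ω : Ω) => I.n s.1 s.2 ω))

/-- The time at which an input acts. -/
def time : InputIndex N → ℕ :=
  Sum.elim Prod.fst (Sum.elim Prod.fst Prod.fst)

/-- The σ-algebra generated by the inputs with index in `T`. -/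
@[reducible] noncomputable def sigma (T : Set (InputIndex N)) : MeasurableSpace Ω :=
  ⨆ s ∈ T, MeasurableSpace.comap (I.family s) inferInstance

lemma measurable_family (s : InputIndex N) : Measurable (I.family s) := by
  rcases s with s | s | s
  · exact Complex.measurable_ofReal.comp (I.measurable_γ s.1 s.2)
  · exact I.measurable_h s.1 s.2.1 s.2.2
  · exact I.measurable_n s.1 s.2

lemma sigma_le (T : Set (InputIndex N)) : I.sigma T ≤ mΩ :=
  iSup₂_le fun s _ => (I.measurable_family s).comap_le

lemma sigma_mono {T T' : Set (InputIndex N)} (h : T ⊆ T') : I.sigma T ≤ I.sigma T' :=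
  biSup_mono h

lemma indepFun_of_disjoint {T T' : Set (InputIndex N)} (hT : Disjoint T T') {β γ : Type*}
    [MeasurableSpace β] [MeasurableSpace γ] {f : Ω → β} {g : Ω → γ}
    (hf : Measurable[I.sigma T] f) (hg : Measurable[I.sigma T'] g) : IndepFun f g μ :=
  indepFun_of_measurable_iSup_comap I.measurable_family I.indep hT hf hg

/-- The information available before time `k`. -/
noncomputable def past : Filtration ℕ mΩ where
  seq k := I.sigma {s | time s < k}
  mono' _ _ hkl := I.sigma_mono fun _ hs => lt_of_lt_of_le hs hkl
  le' _ := I.sigma_le _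

/-- The inputs that affect agent `i` at time `k`. -/
def current (k : ℕ) (i : Fin N) (ω : Ω) : (Fin N → ℝ) × (Fin N → ℂ) × ℂ :=
  (fun j => I.γ k j ω, fun j => I.h k i j ω, I.n k i ω)

section MeasurableOfMem

variable {I} {T : Set (InputIndex N)} {k : ℕ} {i j : Fin N}

lemma measurable_family_of_mem {s : InputIndex N} (hs : s ∈ T) :
    Measurable[I.sigma T] (I.family s) :=
  measurable_iff_comap_le.2
    (le_iSup₂_of_le (f := fun s (_ : s ∈ T) => MeasurableSpace.comap (I.family s) inferInstance)
      s hs le_rfl)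

lemma measurable_γ_of_mem (hi : Sum.inl (k, i) ∈ T) : Measurable[I.sigma T] (I.γ k i) :=
  Complex.measurable_re.comp (measurable_family_of_mem (I := I) hi)

lemma measurable_h_of_mem (hij : Sum.inr (Sum.inl (k, i, j)) ∈ T) :
    Measurable[I.sigma T] (I.h k i j) :=
  measurable_family_of_mem (I := I) hij

lemma measurable_n_of_mem (hi : Sum.inr (Sum.inr (k, i)) ∈ T) :
    Measurable[I.sigma T] (I.n k i) :=
  measurable_family_of_mem (I := I) hi

lemma measurable_Γ_of_mem (hi : Sum.inl (k, i) ∈ T) (hj : Sum.inl (k, j) ∈ T) :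
    Measurable[I.sigma T] (I.Γ k i j) := by
  have hγi := measurable_γ_of_mem (I := I) hi
  have hγj := measurable_γ_of_mem (I := I) hj
  exact (hγi.mul (measurable_const.sub hγj)).add (hγj.mul (measurable_const.sub hγi))

end MeasurableOfMem

lemma measurable_current_sigma (k : ℕ) (i : Fin N) :
    Measurable[I.sigma {s | time s = k}] (I.current k i) :=
  Measurable.prodMk
    (@measurable_pi_lambda _ _ _ (I.sigma _) _ _ fun _ => measurable_γ_of_mem rfl)
    (Measurable.prodMk
      (@measurable_pi_lambda _ _ _ (I.sigma _) _ _ fun _ => measurable_h_of_mem rfl)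
      (measurable_n_of_mem rfl))

lemma measurable_current (k : ℕ) (i : Fin N) : Measurable (I.current k i) :=
  (I.measurable_current_sigma k i).mono (I.sigma_le _) le_rfl

lemma measurable_current_past (k : ℕ) (i : Fin N) :
    Measurable[I.past (k + 1)] (I.current k i) :=
  (I.measurable_current_sigma k i).mono
    (I.sigma_mono fun _ (hs : time _ = k) => hs.trans_lt k.lt_succ_self) le_rfl

lemma indep_past_current (k : ℕ) (i : Fin N) :
    Indep (I.past k) (MeasurableSpace.comap (I.current k i) inferInstance) μ :=
  indep_of_indep_of_le_right
    (indep_iSup_of_disjoint (fun s => (I.measurable_family s).comap_le) I.indep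
      (Set.disjoint_left.2 fun _ (hlt : time _ < k) (heq : time _ = k) => hlt.ne heq))
    (I.measurable_current_sigma k i).comap_le

lemma indepFun_current {k : ℕ} {β : Type*} [MeasurableSpace β] {Z : Ω → β}
    (hZ : Measurable[I.past k] Z) (i : Fin N) : IndepFun Z (I.current k i) μ :=
  (IndepFun_iff_Indep _ _ _).2 (indep_of_indep_of_le_left (I.indep_past_current k i) hZ.comap_le)

end Inputs

end InputSigmaAlgebras

lemma System.exists_integral_norm_pow_four_le {N : ℕ} (S : System N) :
    ∃ c : ℝ≥0, (∀ i j, ∫ z, ‖z‖ ^ 4 ∂complexGaussian (S.Λ i j) ≤ c) ∧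
      ∀ i, ∫ z, ‖z‖ ^ 4 ∂complexGaussian (S.σ i ^ 2) ≤ c := by
  obtain ⟨c, hc⟩ := Finite.exists_le (Sum.elim
    (fun q : Fin N × Fin N => ∫ z, ‖z‖ ^ 4 ∂complexGaussian (S.Λ q.1 q.2))
    (fun i : Fin N => ∫ z, ‖z‖ ^ 4 ∂complexGaussian (S.σ i ^ 2)))
  exact ⟨c.toNNReal, fun i j => (hc (.inl (i, j))).trans c.le_coe_toNNReal,
    fun i => (hc (.inr i)).trans c.le_coe_toNNReal⟩

namespace Inputs

variable {N : ℕ} {S : System N} {Ω : Type*} [mΩ : MeasurableSpace Ω] {μ : Measure Ω}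
  (I : Inputs S μ)

section InputMoments

lemma memLp_h (k : ℕ) (i j : Fin N) {p : ENNReal} (hp : p ≠ ⊤) : MemLp (I.h k i j) p μ := by
  have hid := memLp_id_complexGaussian (S.Λ i j) hp
  rw [← (I.h_law k i j).map_eq] at hid
  exact hid.comp_of_map (I.measurable_h k i j).aemeasurable

lemma memLp_n (k : ℕ) (i : Fin N) {p : ENNReal} (hp : p ≠ ⊤) : MemLp (I.n k i) p μ := by
  have hid := memLp_id_complexGaussian (S.σ i ^ 2) hp
  rw [← (I.n_law k i).map_eq] at hid
  exact hid.comp_of_map (I.measurable_n k i).aemeasurable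

lemma integral_h (k : ℕ) (i j : Fin N) : ∫ ω, I.h k i j ω ∂μ = 0 :=
  (I.h_law k i j).integral_eq.trans (integral_id_complexGaussian _)

lemma integral_n (k : ℕ) (i : Fin N) : ∫ ω, I.n k i ω ∂μ = 0 :=
  (I.n_law k i).integral_eq.trans (integral_id_complexGaussian _)

lemma integral_norm_pow_h (m k : ℕ) (i j : Fin N) :
    ∫ ω, ‖I.h k i j ω‖ ^ m ∂μ = ∫ z, ‖z‖ ^ m ∂complexGaussian (S.Λ i j) :=
  (I.h_law k i j).integral_comp (f := fun z : ℂ => ‖z‖ ^ m) (by fun_prop)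

lemma integral_norm_pow_n (m k : ℕ) (i : Fin N) :
    ∫ ω, ‖I.n k i ω‖ ^ m ∂μ = ∫ z, ‖z‖ ^ m ∂complexGaussian (S.σ i ^ 2) :=
  (I.n_law k i).integral_comp (f := fun z : ℂ => ‖z‖ ^ m) (by fun_prop)

lemma Γ_sq (k : ℕ) (i j : Fin N) (ω : Ω) : I.Γ k i j ω ^ 2 = I.Γ k i j ω := by
  rcases I.γ_zero_or_one k i ω with hi | hi <;> rcases I.γ_zero_or_one k j ω with hj | hj <;>
    simp [Γ, hi, hj]

lemma abs_Γ_le_one (k : ℕ) (i j : Fin N) (ω : Ω) : |I.Γ k i j ω| ≤ 1 := by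
  rcases I.γ_zero_or_one k i ω with hi | hi <;> rcases I.γ_zero_or_one k j ω with hj | hj <;>
    simp [Γ, hi, hj]

lemma measurable_Γ (k : ℕ) (i j : Fin N) : Measurable (I.Γ k i j) :=
  (measurable_Γ_of_mem (T := Set.univ) trivial trivial).mono (I.sigma_le _) le_rfl

lemma integral_γ (k : ℕ) (i : Fin N) : ∫ ω, I.γ k i ω ∂μ = S.p i := by
  have hindicator : I.γ k i = Set.indicator {ω | I.γ k i ω = 1} 1 := by
    ext ω
    rcases I.γ_zero_or_one k i ω with h | h <;> simp [h]
  have hmeas : MeasurableSet {ω | I.γ k i ω = 1} := I.measurable_γ k i (measurableSet_singleton 1)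
  rw [hindicator, integral_indicator_one hmeas, measureReal_def, I.γ_law,
    ENNReal.toReal_ofReal (S.p_mem i).1.le]

end InputMoments

section Contributions

/-- The summand `Γ_ij(k) h_ij(k) s_j(k)` that agent `j` contributes to the signal received by agent
`i` when `j` is a neighbour of `i`. -/
noncomputable def contribution (k : ℕ) (x : Fin N → ℝ) (i j : Fin N) (ω : Ω) : ℂ :=
  (I.Γ k i j ω : ℂ) * I.h k i j ω * S.signal (x j)

lemma norm_contribution_le (k : ℕ) (x : Fin N → ℝ) (i j : Fin N) (ω : Ω) :
    ‖I.contribution k x i j ω‖ ≤ ‖I.h k i j ω‖ * ‖S.signal (x j)‖ := by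
  rw [contribution, norm_mul, norm_mul, Complex.norm_real]
  gcongr
  exact mul_le_of_le_one_left (norm_nonneg _) (I.abs_Γ_le_one k i j ω)

lemma measurable_contribution_of_mem {T : Set (InputIndex N)} {k : ℕ} {i j : Fin N}
    (hi : Sum.inl (k, i) ∈ T) (hj : Sum.inl (k, j) ∈ T) (hij : Sum.inr (Sum.inl (k, i, j)) ∈ T)
    (x : Fin N → ℝ) : Measurable[I.sigma T] (I.contribution k x i j) :=
  ((Complex.measurable_ofReal.comp (measurable_Γ_of_mem hi hj)).mul
    (measurable_h_of_mem hij)).mul measurable_const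

lemma memLp_contribution (k : ℕ) (x : Fin N → ℝ) (i j : Fin N) {p : ENNReal} (hp : p ≠ ⊤) :
    MemLp (I.contribution k x i j) p μ := by
  have hmeas : Measurable (I.contribution k x i j) :=
    (I.measurable_contribution_of_mem (T := Set.univ) trivial trivial trivial x).mono
      (I.sigma_le _) le_rfl
  refine ((I.memLp_h k i j hp).mul_const (S.signal (x j))).mono hmeas.aestronglyMeasurable
    (ae_of_all _ fun ω => ?_)
  rw [norm_mul]
  exact I.norm_contribution_le k x i j ω

lemma memLp_received (k : ℕ) (x : Fin N → ℝ) (i : Fin N) {p : ENNReal} (hp : p ≠ ⊤) :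
    MemLp (I.received k x i) p μ := by
  classical
  exact (memLp_finsetSum _ fun j _ => I.memLp_contribution k x i j hp).add (I.memLp_n k i hp)

end Contributions

section FourthMoment

lemma norm_received_pow_four_le (k : ℕ) (x : Fin N → ℝ) (i : Fin N) (ω : Ω) :
    ‖I.received k x i ω‖ ^ 4 ≤
      8 * (N ^ 3 * ∑ j, ‖I.h k i j ω‖ ^ 4 * (S.ρ ^ 2 * x j ^ 2) + ‖I.n k i ω‖ ^ 4) := by
  classical
  have hnorm : ‖I.received k x i ω‖ ≤
      (∑ j, ‖I.h k i j ω‖ * ‖S.signal (x j)‖) + ‖I.n k i ω‖ := by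
    refine (norm_add_le _ _).trans (add_le_add_left ?_ _)
    refine (norm_sum_le_of_le _ fun j _ => I.norm_contribution_le k x i j ω).trans ?_
    exact Finset.sum_le_sum_of_subset_of_nonneg (Finset.filter_subset _ _)
      fun j _ _ => by positivity
  have hpower : (∑ j, ‖I.h k i j ω‖ * ‖S.signal (x j)‖) ^ 4 ≤
      N ^ 3 * ∑ j, ‖I.h k i j ω‖ ^ 4 * (S.ρ ^ 2 * x j ^ 2) := by
    simpa only [mul_pow, Nat.reduceAdd, S.norm_signal_pow_four, Finset.card_univ,
      Fintype.card_fin] using pow_sum_le_card_mul_sum_pow (s := Finset.univ)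
        (f := fun j => ‖I.h k i j ω‖ * ‖S.signal (x j)‖) (fun j _ => by positivity) 3
  calc ‖I.received k x i ω‖ ^ 4
      ≤ ((∑ j, ‖I.h k i j ω‖ * ‖S.signal (x j)‖) + ‖I.n k i ω‖) ^ 4 := by gcongr
    _ ≤ 2 ^ 3 * ((∑ j, ‖I.h k i j ω‖ * ‖S.signal (x j)‖) ^ 4 + ‖I.n k i ω‖ ^ 4) :=
        add_pow_le (by positivity) (norm_nonneg _) 4
    _ ≤ 8 * (N ^ 3 * ∑ j, ‖I.h k i j ω‖ ^ 4 * (S.ρ ^ 2 * x j ^ 2) + ‖I.n k i ω‖ ^ 4) := by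
        rw [show (2 : ℝ) ^ 3 = 8 by norm_num]
        gcongr

lemma integrable_norm_received_pow_four (k : ℕ) (x : Fin N → ℝ) (i : Fin N) :
    Integrable (fun ω => ‖I.received k x i ω‖ ^ 4) μ :=
  (I.memLp_received k x i (ENNReal.natCast_ne_top 4)).integrable_norm_pow four_ne_zero

lemma exists_integral_norm_received_pow_four_le :
    ∃ M : ℝ≥0, ∀ k x i, ∫ ω, ‖I.received k x i ω‖ ^ 4 ∂μ ≤ M * (1 + ∑ j, x j ^ 2) := by
  obtain ⟨c, hΛ, hσ⟩ := S.exists_integral_norm_pow_four_le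
  refine ⟨8 * c * (1 + N ^ 3 * S.ρ.toNNReal ^ 2), fun k x i => ?_⟩
  have hh j : Integrable (fun ω => ‖I.h k i j ω‖ ^ 4 * (S.ρ ^ 2 * x j ^ 2)) μ :=
    ((I.memLp_h k i j (ENNReal.natCast_ne_top 4)).integrable_norm_pow four_ne_zero).mul_const _
  have hn : Integrable (fun ω => ‖I.n k i ω‖ ^ 4) μ :=
    (I.memLp_n k i (ENNReal.natCast_ne_top 4)).integrable_norm_pow four_ne_zero
  have hsum := (integrable_finsetSum Finset.univ fun j _ => hh j).const_mul ((N : ℝ) ^ 3)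
  calc ∫ ω, ‖I.received k x i ω‖ ^ 4 ∂μ
      ≤ ∫ ω, 8 * (N ^ 3 * ∑ j, ‖I.h k i j ω‖ ^ 4 * (S.ρ ^ 2 * x j ^ 2)
          + ‖I.n k i ω‖ ^ 4) ∂μ :=
        integral_mono (I.integrable_norm_received_pow_four k x i) ((hsum.add hn).const_mul 8)
          (I.norm_received_pow_four_le k x i)
    _ = 8 * (N ^ 3 * ∑ j, (∫ z, ‖z‖ ^ 4 ∂complexGaussian (S.Λ i j)) * (S.ρ ^ 2 * x j ^ 2)
          + ∫ z, ‖z‖ ^ 4 ∂complexGaussian (S.σ i ^ 2)) := by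
        rw [integral_const_mul, integral_add hsum hn, integral_const_mul,
          integral_finsetSum _ fun j _ => hh j]
        simp_rw [integral_mul_const, I.integral_norm_pow_h, I.integral_norm_pow_n]
    _ ≤ 8 * (N ^ 3 * ∑ j, c * (S.ρ ^ 2 * x j ^ 2) + c) := by
        gcongr
        exacts [hΛ i _, hσ i]
    _ = 8 * c * (1 + N ^ 3 * S.ρ ^ 2 * ∑ j, x j ^ 2) := by
        rw [← Finset.mul_sum, ← Finset.mul_sum]
        ring
    _ ≤ 8 * c * ((1 + N ^ 3 * S.ρ ^ 2) * (1 + ∑ j, x j ^ 2)) := by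
        gcongr
        have hx : 0 ≤ ∑ j, x j ^ 2 := by positivity
        have hN : 0 ≤ (N : ℝ) ^ 3 * S.ρ ^ 2 := by positivity
        linarith
    _ = _ := by
        push_cast [Real.coe_toNNReal _ S.ρ_pos.le]
        ring

end FourthMoment

section SecondMoment

variable [IsProbabilityMeasure μ]

lemma integral_Γ (k : ℕ) {i j : Fin N} (hij : i ≠ j) :
    ∫ ω, I.Γ k i j ω ∂μ = S.p i * (1 - S.p j) + S.p j * (1 - S.p i) := by
  have hint i : Integrable (I.γ k i) μ :=
    Integrable.of_bound (I.measurable_γ k i).aestronglyMeasurable 1 (ae_of_all _ fun ω => by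
      rcases I.γ_zero_or_one k i ω with h | h <;> simp [h])
  have hind : IndepFun (I.γ k i) (I.γ k j) μ :=
    I.indepFun_of_disjoint (T := {Sum.inl (k, i)}) (T' := {Sum.inl (k, j)})
      (by simpa using hij) (measurable_γ_of_mem rfl) (measurable_γ_of_mem rfl)
  have hprod := hind.integral_fun_mul_eq_mul_integral (hint i).1 (hint j).1
  have hprod_int : Integrable (fun ω => I.γ k i ω * I.γ k j ω) μ :=
    hind.integrable_mul (hint i) (hint j)
  have hexpand ω : I.Γ k i j ω = I.γ k i ω + I.γ k j ω - 2 * (I.γ k i ω * I.γ k j ω) := by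
    rw [Γ]
    ring
  have hadd : Integrable (fun ω => I.γ k i ω + I.γ k j ω) μ := (hint i).add (hint j)
  simp_rw [hexpand]
  rw [integral_sub hadd (hprod_int.const_mul 2), integral_add (hint i) (hint j),
    integral_const_mul, hprod, I.integral_γ, I.integral_γ]
  ring

lemma integral_norm_contribution_sq (k : ℕ) (x : Fin N → ℝ) {i j : Fin N} (hij : i ≠ j) :
    ∫ ω, ‖I.contribution k x i j ω‖ ^ 2 ∂μ =
      S.ρ * (S.p i * (1 - S.p j) + S.p j * (1 - S.p i)) * S.Λ i j * |x j| := by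
  have hnorm ω : ‖I.contribution k x i j ω‖ ^ 2 =
      (I.Γ k i j ω * ‖I.h k i j ω‖ ^ 2) * (S.ρ * |x j|) := by
    rw [contribution, norm_mul, norm_mul, mul_pow, mul_pow, S.norm_signal_sq, Complex.norm_real,
      Real.norm_eq_abs, sq_abs, I.Γ_sq]
  have hind : IndepFun (I.Γ k i j) (fun ω => ‖I.h k i j ω‖ ^ 2) μ :=
    I.indepFun_of_disjoint (T := Set.range Sum.inl) (T' := Set.range Sum.inr)
      Set.isCompl_range_inl_range_inr.disjoint
      (measurable_Γ_of_mem ⟨_, rfl⟩ ⟨_, rfl⟩)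
      ((measurable_norm.pow_const 2).comp (measurable_h_of_mem ⟨_, rfl⟩))
  simp_rw [hnorm]
  rw [integral_mul_const, hind.integral_fun_mul_eq_mul_integral
    (I.measurable_Γ k i j).aestronglyMeasurable
    ((I.measurable_h k i j).norm.pow_const 2).aestronglyMeasurable, I.integral_Γ k hij,
    I.integral_norm_pow_h, integral_norm_sq_complexGaussian]
  ring

lemma integral_inner_contribution (k : ℕ) (x : Fin N → ℝ) (i : Fin N) {j l : Fin N}
    (hjl : j ≠ l) :
    ∫ ω, inner ℝ (I.contribution k x i j ω) (I.contribution k x i l ω) ∂μ = 0 := by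
  let Y : Ω → ℂ := fun ω =>
    (I.Γ k i l ω : ℂ) * star (S.signal (x l)) * I.contribution k x i j ω
  have hY : Measurable[I.sigma {Sum.inr (Sum.inl (k, i, l))}ᶜ] Y :=
    ((Complex.measurable_ofReal.comp (measurable_Γ_of_mem (by simp) (by simp))).mul
      measurable_const).mul (I.measurable_contribution_of_mem (by simp) (by simp) (by simp [hjl]) x)
  have hYint : Integrable Y μ := by
    refine ((I.memLp_contribution k x i j ENNReal.one_ne_top).integrable le_rfl).norm.const_mul
      ‖S.signal (x l)‖ |>.mono' (hY.mono (I.sigma_le _) le_rfl).aestronglyMeasurable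
      (ae_of_all _ fun ω => ?_)
    rw [norm_mul, norm_mul, norm_star, Complex.norm_real]
    gcongr
    exact mul_le_of_le_one_left (norm_nonneg _) (I.abs_Γ_le_one k i l ω)
  have hinner ω : inner ℝ (I.contribution k x i j ω) (I.contribution k x i l ω) =
      inner ℝ (Y ω) (I.h k i l ω) := by
    simp only [Y, contribution, Complex.inner, map_mul, Complex.conj_ofReal, Complex.star_def,
      Complex.conj_conj]
    congr 1
    ring
  simp_rw [hinner]
  exact integral_inner_eq_zero_of_indepFun
    (I.indepFun_of_disjoint disjoint_compl_left hY (measurable_h_of_mem rfl)) hYint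
    ((I.memLp_h k i l ENNReal.one_ne_top).integrable le_rfl) (I.integral_h k i l)

lemma integral_norm_received_sq (k : ℕ) (x : Fin N → ℝ) (i : Fin N) :
    ∫ ω, ‖I.received k x i ω‖ ^ 2 ∂μ = (S.σ i : ℝ) ^ 2 + ∑ j, S.abar k i j * |x j| := by
  classical
  let signals : Ω → ℂ := fun ω => ∑ j with (S.G k).Adj i j, I.contribution k x i j ω
  have hmemLp j : MemLp (I.contribution k x i j) 2 μ :=
    I.memLp_contribution k x i j ENNReal.ofNat_ne_top
  have hsignals : MemLp signals 2 μ := memLp_finsetSum _ fun j _ => hmemLp j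
  have hn : MemLp (I.n k i) 2 μ := I.memLp_n k i ENNReal.ofNat_ne_top
  have hmeas : Measurable[I.sigma {Sum.inr (Sum.inr (k, i))}ᶜ] signals :=
    Finset.measurable_sum _ fun j _ =>
      I.measurable_contribution_of_mem (by simp) (by simp) (by simp) x
  have horth : ∫ ω, inner ℝ (signals ω) (I.n k i ω) ∂μ = 0 :=
    integral_inner_eq_zero_of_indepFun
      (I.indepFun_of_disjoint disjoint_compl_left hmeas (measurable_n_of_mem rfl))
      (hsignals.integrable one_le_two) (hn.integrable one_le_two) (I.integral_n k i)
  have hweight j (hj : j ∈ Finset.univ.filter ((S.G k).Adj i)) :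
      ∫ ω, ‖I.contribution k x i j ω‖ ^ 2 ∂μ = S.abar k i j * |x j| := by
    have hadj : (S.G k).Adj i j := (Finset.mem_filter.1 hj).2
    rw [I.integral_norm_contribution_sq k x hadj.ne, S.abar_of_adj hadj]
  calc ∫ ω, ‖I.received k x i ω‖ ^ 2 ∂μ
      = ∫ ω, ‖signals ω‖ ^ 2 ∂μ + ∫ ω, ‖I.n k i ω‖ ^ 2 ∂μ :=
        integral_norm_add_sq_of_integral_inner_eq_zero hsignals hn horth
    _ = ∑ j with (S.G k).Adj i j, S.abar k i j * |x j| + (S.σ i : ℝ) ^ 2 := by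
        rw [integral_norm_sum_sq_of_pairwise hmemLp
          fun j l hjl => I.integral_inner_contribution k x i hjl, Finset.sum_congr rfl hweight,
          I.integral_norm_pow_n, integral_norm_sq_complexGaussian, NNReal.coe_pow]
    _ = (S.σ i : ℝ) ^ 2 + ∑ j, S.abar k i j * |x j| := by
        rw [add_comm, Finset.sum_filter_of_ne]
        intro j _ hj
        by_contra hadj
        exact hj (by rw [S.abar_of_not_adj hadj, zero_mul])

end SecondMoment

end Inputs

namespace System

variable {N : ℕ} (S : System N)

section MeanStep

/-- The conditional mean of the states at time `k + 1`, given that the states at time `k` are `x`.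
The absolute values come from the power `ρ |x j|` of the signal sent by `j`. -/
noncomputable def meanStep (k : ℕ) (x : Fin N → ℝ) (i : Fin N) : ℝ :=
  (1 - S.α k * ∑ j, S.abar k i j) * x i + S.α k * ∑ j, S.abar k i j * |x j|

/-- The part of `meanStep` that is due to negative states: they are received as their absolute
values. -/
noncomputable def signDrift (k : ℕ) (x : Fin N → ℝ) (i : Fin N) : ℝ :=
  S.α k * ∑ j, S.abar k i j * (|x j| - x j)

lemma measurable_meanStep (k : ℕ) (i : Fin N) : Measurable fun x => S.meanStep k x i := by
  unfold meanStep
  fun_prop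

lemma signDrift_nonneg (k : ℕ) (x : Fin N → ℝ) (i : Fin N) : 0 ≤ S.signDrift k x i :=
  mul_nonneg (S.α_pos k).le (Finset.sum_nonneg fun j _ =>
    mul_nonneg (S.abar_nonneg k i j) (sub_nonneg.2 (le_abs_self _)))

lemma meanStep_eq (k : ℕ) (x : Fin N → ℝ) (i : Fin N) : S.meanStep k x i =
    x i - S.α k * ∑ j, S.abar k i j * (x i - x j) + S.signDrift k x i := by
  simp only [meanStep, signDrift, mul_sub, Finset.sum_sub_distrib, ← Finset.sum_mul]
  ring

lemma sum_meanStep (k : ℕ) (x : Fin N → ℝ) :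
    ∑ i, S.meanStep k x i = ∑ i, x i + ∑ i, S.signDrift k x i := by
  have hlap := sum_laplacian (S.abar_symm k) (WithLp.toLp 2 x)
  simp only [laplacian_apply] at hlap
  simp_rw [meanStep_eq, Finset.sum_add_distrib, Finset.sum_sub_distrib, ← Finset.mul_sum, hlap,
    mul_zero, sub_zero]

lemma meanStep_sq_le {k : ℕ} {i : Fin N} (hw : 0 ≤ 1 - S.α k * ∑ j, S.abar k i j)
    (x : Fin N → ℝ) : S.meanStep k x i ^ 2 ≤
      (1 - S.α k * ∑ j, S.abar k i j) * x i ^ 2 + S.α k * ∑ j, S.abar k i j * x j ^ 2 := by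
  have hjensen := (even_two.convexOn_pow (𝕜 := ℝ)).map_add_sum_le (t := Finset.univ)
    (w := fun j => S.α k * S.abar k i j) (p := fun j => |x j|) (q := x i)
    (fun j _ => mul_nonneg (S.α_pos k).le (S.abar_nonneg k i j))
    (by rw [← Finset.mul_sum, sub_add_cancel]) (fun _ _ => Set.mem_univ _) hw (Set.mem_univ _)
  simpa only [meanStep, smul_eq_mul, sq_abs, mul_assoc, ← Finset.mul_sum] using hjensen

lemma sum_meanStep_sq_le {k : ℕ} (hw : ∀ i, 0 ≤ 1 - S.α k * ∑ j, S.abar k i j)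
    (x : Fin N → ℝ) : ∑ i, S.meanStep k x i ^ 2 ≤ ∑ i, x i ^ 2 := by
  calc ∑ i, S.meanStep k x i ^ 2
      ≤ ∑ i, ((1 - S.α k * ∑ j, S.abar k i j) * x i ^ 2
          + S.α k * ∑ j, S.abar k i j * x j ^ 2) :=
        Finset.sum_le_sum fun i _ => S.meanStep_sq_le (hw i) x
    _ = ∑ i, x i ^ 2 - S.α k * ∑ i, ∑ j, S.abar k i j * x i ^ 2
          + S.α k * ∑ i, ∑ j, S.abar k i j * x j ^ 2 := by
        simp only [sub_mul, one_mul, mul_assoc, Finset.sum_mul, Finset.sum_add_distrib,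
          Finset.sum_sub_distrib, ← Finset.mul_sum]
    _ = ∑ i, x i ^ 2 := by
        rw [Finset.sum_comm (f := fun i j => S.abar k i j * x j ^ 2)]
        simp_rw [S.abar_symm k _ _, sub_add_cancel]

end MeanStep

section UniformBounds

lemma exists_sum_abar_le : ∃ d > 0, ∀ k i, ∑ j, S.abar k i j ≤ d := by
  set W : Fin N → Fin N → ℝ := fun i j =>
    S.ρ * (S.p i * (1 - S.p j) + S.p j * (1 - S.p i)) * S.Λ i j
  have hW i j : 0 ≤ W i j :=
    mul_nonneg (mul_pos S.ρ_pos (S.slot_ne_prob_pos i j)).le (S.Λ i j).coe_nonneg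
  have habar k i j : S.abar k i j ≤ W i j := by
    by_cases hij : (S.G k).Adj i j
    · exact (S.abar_of_adj hij).le
    · exact (S.abar_of_not_adj hij).trans_le (hW i j)
  obtain ⟨d, hd⟩ := Finite.exists_le fun i => ∑ j, W i j
  exact ⟨max d 1, by positivity, fun k i =>
    (Finset.sum_le_sum fun j _ => habar k i j).trans ((hd i).trans (le_max_left d 1))⟩

lemma exists_le_abar : ∃ m > 0, ∀ k i j, (S.G k).Adj i j → m ≤ S.abar k i j := by
  have hev : ∀ᶠ m in 𝓝[>] (0 : ℝ), ∀ i j, (∃ k, (S.G k).Adj i j) →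
      m ≤ S.ρ * (S.p i * (1 - S.p j) + S.p j * (1 - S.p i)) * S.Λ i j := by
    simp_rw [eventually_all]
    rintro i j ⟨k, hij⟩
    refine nhdsWithin_le_nhds (eventually_le_nhds ?_)
    rw [← S.abar_of_adj hij]
    exact S.abar_pos hij
  obtain ⟨m, hm, hm₀⟩ := (hev.and self_mem_nhdsWithin).exists
  exact ⟨m, hm₀, fun k i j hij => (hm i j ⟨k, hij⟩).trans_eq (S.abar_of_adj hij).symm⟩

end UniformBounds

section InnovationMap

/-- The signal received by agent `i` at time `k`, as a function of the states and of the inputs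
`Inputs.current` of the agent. -/
noncomputable def receivedMap (k : ℕ) (i : Fin N)
    (q : (Fin N → ℝ) × ((Fin N → ℝ) × (Fin N → ℂ) × ℂ)) : ℂ :=
  open Classical in
  (∑ j with (S.G k).Adj i j,
    ((q.2.1 i * (1 - q.2.1 j) + q.2.1 j * (1 - q.2.1 i) : ℝ) : ℂ) * q.2.2.1 j
      * S.signal (q.1 j)) + q.2.2.2

/-- The deviation of the increment of agent `i` at time `k` (before scaling by the step size) from
its conditional mean, as a function of the states and of the inputs of the agent. -/
noncomputable def innovationMap (k : ℕ) (i : Fin N)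
    (q : (Fin N → ℝ) × ((Fin N → ℝ) × (Fin N → ℂ) × ℂ)) : ℝ :=
  open Classical in
  if i ∈ S.failed k then 0
  else ‖S.receivedMap k i q‖ ^ 2 - ((S.σ i : ℝ) ^ 2 + ∑ j, S.abar k i j * |q.1 j|)

lemma measurable_innovationMap (k : ℕ) (i : Fin N) : Measurable (S.innovationMap k i) := by
  unfold innovationMap receivedMap
  have hsignal := S.measurable_signal
  split_ifs <;> fun_prop

end InnovationMap

end System

namespace Inputs

variable {N : ℕ} {S : System N} {Ω : Type*} [mΩ : MeasurableSpace Ω] {μ : Measure Ω}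
  (I : Inputs S μ)

section Innovation

/-- The martingale difference in the recursion of agent `i` at time `k`. -/
noncomputable def innovation (k : ℕ) (i : Fin N) (ω : Ω) : ℝ :=
  S.innovationMap k i (I.state k ω, I.current k i ω)

lemma innovationMap_current_of_failed {k : ℕ} {i : Fin N} (hi : i ∈ S.failed k)
    (x : Fin N → ℝ) (ω : Ω) : S.innovationMap k i (x, I.current k i ω) = 0 :=
  if_pos hi

lemma innovationMap_current {k : ℕ} {i : Fin N} (hi : i ∉ S.failed k) (x : Fin N → ℝ) (ω : Ω) :
    S.innovationMap k i (x, I.current k i ω) =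
      ‖I.received k x i ω‖ ^ 2 - ((S.σ i : ℝ) ^ 2 + ∑ j, S.abar k i j * |x j|) :=
  if_neg hi

lemma state_succ (k : ℕ) (ω : Ω) (i : Fin N) :
    I.state (k + 1) ω i = S.meanStep k (I.state k ω) i + S.α k * I.innovation k i ω := by
  by_cases hi : i ∈ S.failed k
  · simp only [state, if_pos hi, System.meanStep, innovation,
      I.innovationMap_current_of_failed hi, S.abar_of_failed hi, zero_mul, Finset.sum_const_zero,
      mul_zero, sub_zero, one_mul, add_zero]
  · simp only [state, if_neg hi, System.meanStep, innovation, I.innovationMap_current hi]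
    ring

lemma toLp_state_succ (k : ℕ) (ω : Ω) : WithLp.toLp 2 (I.state (k + 1) ω) =
    WithLp.toLp 2 (I.state k ω) - S.α k • laplacian (S.abar k) (WithLp.toLp 2 (I.state k ω))
      + WithLp.toLp 2 fun i =>
        S.signDrift k (I.state k ω) i + S.α k * I.innovation k i ω := by
  ext i
  simp only [PiLp.add_apply, PiLp.sub_apply, PiLp.smul_apply, smul_eq_mul, laplacian_apply,
    state_succ, S.meanStep_eq, add_assoc]

lemma measurable_state_past (k : ℕ) : Measurable[I.past k] (I.state k) := by
  induction k with
  | zero => exact @measurable_const _ _ _ (I.past 0) S.x₀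
  | succ k ih =>
    have hstate : Measurable[I.past (k + 1)] (I.state k) :=
      ih.mono (I.past.mono k.le_succ) le_rfl
    refine @measurable_pi_lambda _ _ _ (I.past (k + 1)) _ _ fun i => ?_
    simp_rw [state_succ]
    exact ((S.measurable_meanStep k i).comp hstate).add (((S.measurable_innovationMap k i).comp
      (hstate.prodMk (I.measurable_current_past k i))).const_mul _)

lemma measurable_state (k : ℕ) : Measurable (I.state k) :=
  (I.measurable_state_past k).mono (I.past.le k) le_rfl

lemma measurable_state_apply (k : ℕ) (i : Fin N) : Measurable fun ω => I.state k ω i :=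
  (measurable_pi_apply i).comp (I.measurable_state k)

lemma measurable_innovation_past (k : ℕ) (i : Fin N) :
    Measurable[I.past (k + 1)] (I.innovation k i) :=
  (S.measurable_innovationMap k i).comp
    (((I.measurable_state_past k).mono (I.past.mono k.le_succ) le_rfl).prodMk
      (I.measurable_current_past k i))

end Innovation

section FrozenMoments

variable [IsProbabilityMeasure μ]

lemma memLp_innovationMap_current (k : ℕ) (x : Fin N → ℝ) (i : Fin N) :
    MemLp (fun ω => S.innovationMap k i (x, I.current k i ω)) 2 μ := by
  by_cases hi : i ∈ S.failed k
  · simp only [I.innovationMap_current_of_failed hi, MemLp.zero']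
  · simp_rw [I.innovationMap_current hi]
    refine MemLp.sub ?_ (memLp_const _)
    have hmeas : AEStronglyMeasurable (fun ω => ‖I.received k x i ω‖ ^ 2) μ :=
      (I.memLp_received k x i ENNReal.one_ne_top).1.norm.pow 2
    refine (memLp_two_iff_integrable_sq hmeas).2 ?_
    simpa only [← pow_mul] using I.integrable_norm_received_pow_four k x i

lemma integral_innovationMap_current (k : ℕ) (x : Fin N → ℝ) (i : Fin N) :
    ∫ ω, S.innovationMap k i (x, I.current k i ω) ∂μ = 0 := by
  by_cases hi : i ∈ S.failed k
  · simp only [I.innovationMap_current_of_failed hi, integral_zero]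
  · have hint : Integrable (fun ω => ‖I.received k x i ω‖ ^ 2) μ :=
      (I.memLp_received k x i (ENNReal.natCast_ne_top 2)).integrable_norm_pow two_ne_zero
    simp_rw [I.innovationMap_current hi]
    rw [integral_sub hint (integrable_const _), I.integral_norm_received_sq, integral_const,
      probReal_univ, one_smul, sub_self]

lemma integral_innovationMap_current_sq_le (k : ℕ) (x : Fin N → ℝ) (i : Fin N) :
    ∫ ω, S.innovationMap k i (x, I.current k i ω) ^ 2 ∂μ ≤ ∫ ω, ‖I.received k x i ω‖ ^ 4 ∂μ := by
  by_cases hi : i ∈ S.failed k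
  · simp only [I.innovationMap_current_of_failed hi, zero_pow two_ne_zero, integral_zero]
    positivity
  · have hmeas : AEStronglyMeasurable (fun ω => ‖I.received k x i ω‖ ^ 2) μ :=
      (I.memLp_received k x i ENNReal.one_ne_top).1.norm.pow 2
    calc ∫ ω, S.innovationMap k i (x, I.current k i ω) ^ 2 ∂μ
        = variance (fun ω => ‖I.received k x i ω‖ ^ 2) μ := by
          simp_rw [variance_eq_integral hmeas.aemeasurable, I.integral_norm_received_sq,
            I.innovationMap_current hi]
      _ ≤ ∫ ω, (‖I.received k x i ω‖ ^ 2) ^ 2 ∂μ := variance_le_expectation_sq hmeas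
      _ = ∫ ω, ‖I.received k x i ω‖ ^ 4 ∂μ := by simp_rw [← pow_mul]

end FrozenMoments

section SecondMoments

lemma memLp_meanStep {k : ℕ} (hx : ∀ i, MemLp (fun ω => I.state k ω i) 2 μ) (i : Fin N) :
    MemLp (fun ω => S.meanStep k (I.state k ω) i) 2 μ :=
  ((hx i).const_mul _).add
    ((memLp_finsetSum _ fun j _ => ((hx j).abs.const_mul _)).const_mul _)

variable [IsProbabilityMeasure μ]

lemma integrable_innovation_sq {k : ℕ} (hx : ∀ i, MemLp (fun ω => I.state k ω i) 2 μ)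
    (i : Fin N) : Integrable (fun ω => I.innovation k i ω ^ 2) μ := by
  obtain ⟨M, hM⟩ := I.exists_integral_norm_received_pow_four_le
  have hsq : StronglyMeasurable fun q => S.innovationMap k i q ^ 2 :=
    ((S.measurable_innovationMap k i).pow_const 2).stronglyMeasurable
  have hmeas : StronglyMeasurable fun x =>
      ∫ ω, ‖S.innovationMap k i (x, I.current k i ω) ^ 2‖ ∂μ :=
    StronglyMeasurable.integral_prod_right
      (f := fun x ω => ‖S.innovationMap k i (x, I.current k i ω) ^ 2‖)
      (hsq.norm.comp_measurable (measurable_id.prodMap (I.measurable_current k i)))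
  refine integrable_comp_prodMk_of_indepFun (F := fun q => S.innovationMap k i q ^ 2)
    (I.measurable_state k) (I.measurable_current k i)
    (I.indepFun_current (I.measurable_state_past k) i) hsq
    (fun x => (I.memLp_innovationMap_current k x i).integrable_sq) ?_
  have hbound : Integrable (fun ω => M * (1 + ∑ j, I.state k ω j ^ 2)) μ :=
    ((integrable_const 1).add
      (integrable_finsetSum _ fun j _ => (hx j).integrable_sq)).const_mul _
  refine hbound.mono' (hmeas.comp_measurable (I.measurable_state k)).aestronglyMeasurable
    (ae_of_all _ fun ω => ?_)
  rw [Real.norm_of_nonneg (integral_nonneg fun _ => norm_nonneg _)]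
  simp_rw [Real.norm_of_nonneg (sq_nonneg _)]
  exact (I.integral_innovationMap_current_sq_le k _ i).trans (hM k _ i)

lemma memLp_innovation_of_memLp_state {k : ℕ} (hx : ∀ i, MemLp (fun ω => I.state k ω i) 2 μ)
    (i : Fin N) : MemLp (I.innovation k i) 2 μ :=
  (memLp_two_iff_integrable_sq
    ((I.measurable_innovation_past k i).mono (I.past.le _) le_rfl).aestronglyMeasurable).2
    (I.integrable_innovation_sq hx i)

lemma memLp_state (k : ℕ) (i : Fin N) : MemLp (fun ω => I.state k ω i) 2 μ := by
  induction k generalizing i with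
  | zero => exact memLp_const (S.x₀ i)
  | succ k ih =>
    simp_rw [state_succ]
    exact (I.memLp_meanStep ih i).add ((I.memLp_innovation_of_memLp_state ih i).const_mul _)

lemma memLp_innovation (k : ℕ) (i : Fin N) : MemLp (I.innovation k i) 2 μ :=
  I.memLp_innovation_of_memLp_state (I.memLp_state k) i

lemma condExp_innovation (k : ℕ) (i : Fin N) : μ[I.innovation k i | I.past k] =ᵐ[μ] 0 := by
  have hmean ω : ∫ ω', S.innovationMap k i (I.state k ω, I.current k i ω') ∂μ = 0 :=
    I.integral_innovationMap_current k (I.state k ω) i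
  have hfreeze := condExp_comp_prodMk_ae_eq (I.past.le k) (I.measurable_state_past k)
    (I.measurable_current k i) (I.indep_past_current k i)
    (S.measurable_innovationMap k i).stronglyMeasurable
    ((I.memLp_innovation k i).integrable one_le_two)
    (by simp_rw [hmean]; exact integrable_const 0)
  simp only [hmean] at hfreeze
  exact hfreeze

lemma condExp_const_mul_innovation (c : ℝ) (k : ℕ) (i : Fin N) :
    μ[fun ω => c * I.innovation k i ω | I.past k] =ᵐ[μ] 0 := by
  filter_upwards [condExp_smul c (I.innovation k i) (I.past k), I.condExp_innovation k i]
    with ω hsmul hzero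
  exact hsmul.trans (by rw [Pi.smul_apply, hzero, Pi.zero_apply, smul_zero])

lemma integral_innovation (k : ℕ) (i : Fin N) : ∫ ω, I.innovation k i ω ∂μ = 0 := by
  rw [← integral_condExp (I.past.le k), integral_congr_ae (I.condExp_innovation k i)]
  exact integral_zero _ _

end SecondMoments

section Energy

/-- The total second moment of the states at time `k`, the Lyapunov function for the boundedness of
the states in mean square. -/
noncomputable def energy (k : ℕ) : ℝ := ∑ i, ∫ ω, I.state k ω i ^ 2 ∂μ

lemma energy_nonneg (k : ℕ) : 0 ≤ I.energy k :=
  Finset.sum_nonneg fun _ _ => integral_nonneg fun _ => sq_nonneg _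

variable [IsProbabilityMeasure μ]

lemma exists_integral_innovation_sq_le_energy :
    ∃ M : ℝ≥0, ∀ k i, ∫ ω, I.innovation k i ω ^ 2 ∂μ ≤ M * (1 + I.energy k) := by
  obtain ⟨M, hM⟩ := I.exists_integral_norm_received_pow_four_le
  refine ⟨M, fun k i => ?_⟩
  have hsq j : Integrable (fun ω => I.state k ω j ^ 2) μ := (I.memLp_state k j).integrable_sq
  have hsum := integrable_finsetSum Finset.univ fun j _ => hsq j
  calc ∫ ω, I.innovation k i ω ^ 2 ∂μ
      = ∫ ω, ∫ ω', S.innovationMap k i (I.state k ω, I.current k i ω') ^ 2 ∂μ ∂μ :=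
        integral_comp_prodMk_of_indepFun (F := fun q => S.innovationMap k i q ^ 2)
          (I.measurable_state k) (I.measurable_current k i)
          (I.indepFun_current (I.measurable_state_past k) i)
          ((S.measurable_innovationMap k i).pow_const 2).stronglyMeasurable
          (I.memLp_innovation k i).integrable_sq
    _ ≤ ∫ ω, M * (1 + ∑ j, I.state k ω j ^ 2) ∂μ :=
        integral_mono_of_nonneg (ae_of_all _ fun ω => integral_nonneg fun ω' => sq_nonneg _)
          (((integrable_const 1).add hsum).const_mul _)
          (ae_of_all _ fun ω => (I.integral_innovationMap_current_sq_le k _ i).trans (hM k _ i))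
    _ = M * (1 + I.energy k) := by
        rw [integral_const_mul, integral_add (integrable_const 1) hsum,
          integral_finsetSum _ fun j _ => hsq j, integral_const, probReal_univ, one_smul, energy]

lemma integral_state_succ_sq (k : ℕ) (i : Fin N) :
    ∫ ω, I.state (k + 1) ω i ^ 2 ∂μ = ∫ ω, S.meanStep k (I.state k ω) i ^ 2 ∂μ
      + S.α k ^ 2 * ∫ ω, I.innovation k i ω ^ 2 ∂μ := by
  have hξ := (I.memLp_innovation k i).const_mul (S.α k)
  simp_rw [state_succ, ← integral_const_mul, ← mul_pow]
  exact integral_add_sq_of_condExp_eq_zero (I.past.le k)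
    ((S.measurable_meanStep k i).comp (I.measurable_state_past k)).stronglyMeasurable
    (I.memLp_meanStep (I.memLp_state k) i) (hξ.integrable one_le_two) hξ
    (I.condExp_const_mul_innovation _ k i)

lemma sum_integral_meanStep_sq_le_energy {k : ℕ}
    (hw : ∀ i, 0 ≤ 1 - S.α k * ∑ j, S.abar k i j) :
    ∑ i, ∫ ω, S.meanStep k (I.state k ω) i ^ 2 ∂μ ≤ I.energy k := by
  have hx i := (I.memLp_state k i).integrable_sq
  have hmean i := (I.memLp_meanStep (I.memLp_state k) i).integrable_sq
  rw [energy, ← integral_finsetSum _ fun i _ => hmean i, ← integral_finsetSum _ fun i _ => hx i]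
  exact integral_mono (integrable_finsetSum _ fun i _ => hmean i)
    (integrable_finsetSum _ fun i _ => hx i) fun ω => S.sum_meanStep_sq_le hw (I.state k ω)

lemma exists_energy_succ_le (hstep : S.StepSize) :
    ∃ C : ℝ≥0, ∀ k, I.energy (k + 1) ≤ (1 + C * S.α k ^ 2) * I.energy k + C * S.α k ^ 2 := by
  obtain ⟨M, hM⟩ := I.exists_integral_innovation_sq_le_energy
  refine ⟨N * M, fun k => ?_⟩
  calc I.energy (k + 1)
      = ∑ i, ∫ ω, S.meanStep k (I.state k ω) i ^ 2 ∂μ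
          + S.α k ^ 2 * ∑ i, ∫ ω, I.innovation k i ω ^ 2 ∂μ := by
        simp_rw [energy, integral_state_succ_sq, Finset.sum_add_distrib, Finset.mul_sum]
    _ ≤ I.energy k + S.α k ^ 2 * ∑ _i : Fin N, M * (1 + I.energy k) := by
        gcongr with i
        · exact I.sum_integral_meanStep_sq_le_energy fun i => (hstep.weight_pos i k).le
        · exact hM k i
    _ = _ := by
        rw [Finset.sum_const, Finset.card_univ, Fintype.card_fin, nsmul_eq_mul]
        push_cast
        ring

lemma exists_energy_le (hstep : S.StepSize) : ∃ V, ∀ k, I.energy k ≤ V := by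
  obtain ⟨C, hC⟩ := I.exists_energy_succ_le hstep
  have hnonneg k : 0 ≤ C * S.α k ^ 2 := by positivity
  have hsum n : ∑ k ∈ Finset.Ico 0 n, C * S.α k ^ 2 ≤ ∑' k, C * S.α k ^ 2 :=
    (hstep.summable_sq.mul_left _).sum_le_tsum _ fun k _ => hnonneg k
  refine ⟨(I.energy 0 + ∑' k, C * S.α k ^ 2) * Real.exp (∑' k, C * S.α k ^ 2), fun n => ?_⟩
  have hgronwall := discrete_gronwall (n₀ := 0) (I.energy_nonneg 0) (fun k _ => hC k)
    (fun k _ => hnonneg k) (fun k _ => hnonneg k) n.zero_le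
  have hE := I.energy_nonneg 0
  exact hgronwall.trans (by gcongr <;> exact hsum n)

lemma exists_integral_innovation_sq_le (hstep : S.StepSize) :
    ∃ B, ∀ k i, ∫ ω, I.innovation k i ω ^ 2 ∂μ ≤ B := by
  obtain ⟨M, hM⟩ := I.exists_integral_innovation_sq_le_energy
  obtain ⟨V, hV⟩ := I.exists_energy_le hstep
  exact ⟨M * (1 + V), fun k i => (hM k i).trans (by gcongr; exact hV k)⟩

end Energy

section Perturbations

variable [IsProbabilityMeasure μ]

lemma ae_exists_tendsto_sum_innovation (hstep : S.StepSize) (i : Fin N) :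
    ∀ᵐ ω ∂μ, ∃ D, Tendsto (fun n => ∑ k ∈ Finset.range n, S.α k * I.innovation k i ω)
      atTop (𝓝 D) := by
  obtain ⟨B, hB⟩ := I.exists_integral_innovation_sq_le hstep
  refine ae_exists_tendsto_sum_of_condExp_eq_zero (ℱ := I.past)
    (fun k => ((I.measurable_innovation_past k i).const_mul _).stronglyMeasurable)
    (fun k => (I.memLp_innovation k i).const_mul _)
    (fun k => I.condExp_const_mul_innovation _ k i) ?_
  refine (hstep.summable_sq.mul_right B).of_nonneg_of_le
    (fun k => integral_nonneg fun ω => sq_nonneg _) fun k => ?_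
  simp_rw [mul_pow, integral_const_mul]
  gcongr
  exact hB k i

lemma integrable_signDrift (k : ℕ) (i : Fin N) :
    Integrable (fun ω => S.signDrift k (I.state k ω) i) μ := by
  have hx j : Integrable (fun ω => I.state k ω j) μ := (I.memLp_state k j).integrable one_le_two
  exact (integrable_finsetSum _ fun j _ => ((hx j).abs.sub (hx j)).const_mul _).const_mul _

lemma integral_sum_state_succ (k : ℕ) : ∫ ω, ∑ i, I.state (k + 1) ω i ∂μ =
    ∫ ω, ∑ i, I.state k ω i ∂μ + ∫ ω, ∑ i, S.signDrift k (I.state k ω) i ∂μ := by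
  have hx := integrable_finsetSum Finset.univ fun i _ =>
    (I.memLp_state k i).integrable one_le_two
  have hdrift := integrable_finsetSum Finset.univ fun i _ => I.integrable_signDrift k i
  have hξ i : Integrable (fun ω => S.α k * I.innovation k i ω) μ :=
    ((I.memLp_innovation k i).integrable one_le_two).const_mul _
  have hmean : Integrable
      (fun ω => ∑ i, I.state k ω i + ∑ i, S.signDrift k (I.state k ω) i) μ := hx.add hdrift
  simp_rw [state_succ, Finset.sum_add_distrib, S.sum_meanStep]
  rw [integral_add hmean (integrable_finsetSum _ fun i _ => hξ i), integral_add hx hdrift,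
    integral_finsetSum _ fun i _ => hξ i]
  simp only [integral_const_mul, integral_innovation, mul_zero, Finset.sum_const_zero, add_zero]

lemma integral_sum_state_le (k : ℕ) : ∫ ω, ∑ i, I.state k ω i ∂μ ≤ N + I.energy k := by
  rw [integral_finsetSum _ fun i _ => (I.memLp_state k i).integrable one_le_two]
  calc ∑ i, ∫ ω, I.state k ω i ∂μ
      ≤ ∑ i, (1 + ∫ ω, I.state k ω i ^ 2 ∂μ) := by
        gcongr with i
        exact (le_abs_self _).trans <| abs_integral_le_integral_abs.trans <|
          integral_abs_le_one_add_integral_sq (I.memLp_state k i)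
    _ = N + I.energy k := by
        simp only [Finset.sum_add_distrib, Finset.sum_const, Finset.card_univ, Fintype.card_fin,
          nsmul_eq_mul, mul_one, energy]

-- The drift is nonnegative and shifts the mean of the total state, which is bounded.
lemma ae_summable_signDrift (hstep : S.StepSize) :
    ∀ᵐ ω ∂μ, ∀ i, Summable fun k => S.signDrift k (I.state k ω) i := by
  obtain ⟨V, hV⟩ := I.exists_energy_le hstep
  have hnonneg k ω : 0 ≤ ∑ i, S.signDrift k (I.state k ω) i :=
    Finset.sum_nonneg fun i _ => S.signDrift_nonneg k _ i
  have htelescope n : ∑ k ∈ Finset.range n, ∫ ω, ∑ i, S.signDrift k (I.state k ω) i ∂μ =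
      ∫ ω, ∑ i, I.state n ω i ∂μ - ∫ ω, ∑ i, I.state 0 ω i ∂μ := by
    simp_rw [← Finset.sum_range_sub fun k => ∫ ω, ∑ i, I.state k ω i ∂μ, integral_sum_state_succ,
      add_sub_cancel_left]
  have hsummable : Summable fun k => ∫ ω, ∑ i, S.signDrift k (I.state k ω) i ∂μ := by
    refine summable_of_sum_range_le (c := N + V - ∫ ω, ∑ i, I.state 0 ω i ∂μ)
      (fun k => integral_nonneg (hnonneg k)) fun n => ?_
    rw [htelescope]
    gcongr
    exact (I.integral_sum_state_le n).trans (by gcongr; exact hV n)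
  filter_upwards [ae_summable_of_summable_integral
    (fun k => integrable_finsetSum _ fun i _ => I.integrable_signDrift k i) hnonneg hsummable]
    with ω hω i
  exact hω.of_nonneg_of_le (fun k => S.signDrift_nonneg k _ i) fun k =>
    Finset.single_le_sum (f := fun i => S.signDrift k (I.state k ω) i)
      (fun j _ => S.signDrift_nonneg k _ j) (Finset.mem_univ i)

theorem ae_exists_tendsto_state (hstep : S.StepSize) (hconn : S.JointlyConnected)
    (hreg : S.StepSizeRegular) :
    ∀ᵐ ω ∂μ, ∃ c, ∀ i, Tendsto (fun k => I.state k ω i) atTop (𝓝 c) := by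
  obtain ⟨d, hd, hdeg⟩ := S.exists_sum_abar_le
  obtain ⟨m, hm, hadj⟩ := S.exists_le_abar
  obtain ⟨L, hL, hconn⟩ := hconn
  have hα₀ : Tendsto S.α atTop (𝓝 0) := by
    simpa only [Real.sqrt_sq (S.α_pos _).le, Real.sqrt_zero] using
      hstep.summable_sq.tendsto_atTop_zero.sqrt
  filter_upwards [ae_all_iff.2 (I.ae_exists_tendsto_sum_innovation hstep),
    I.ae_summable_signDrift hstep] with ω hξ hdrift
  choose D hD using hξ
  set e : ℕ → EuclideanSpace ℝ (Fin N) := fun k => WithLp.toLp 2 fun i =>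
    S.signDrift k (I.state k ω) i + S.α k * I.innovation k i ω
  have he : Tendsto (fun n => ∑ k ∈ Finset.range n, e k) atTop
      (𝓝 (WithLp.toLp 2 fun i => ∑' k, S.signDrift k (I.state k ω) i + D i)) := by
    simp_rw [e, ← WithLp.toLp_sum]
    refine ((PiLp.continuous_toLp 2 _).tendsto _).comp (tendsto_pi_nhds.2 fun i => ?_)
    simp_rw [Finset.sum_apply, Finset.sum_add_distrib]
    exact (hdrift i).hasSum.tendsto_sum_nat.add (hD i)
  obtain ⟨c, hc⟩ := exists_tendsto_const_of_jointlyConnected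
    (x := fun k => WithLp.toLp 2 (I.state k ω)) S.abar_symm S.abar_nonneg hd hdeg hm hadj hL
    hconn S.α_pos (antitone_nat_of_succ_le hreg.le_succ) hα₀ hstep.sum_eq_top hreg.limsup_lt_top
    (fun k => I.toLp_state_succ k ω) he
  exact ⟨c, fun i => ((EuclideanSpace.proj (𝕜 := ℝ) i).continuous.tendsto _).comp hc⟩

end Perturbations

end Inputs

end OverTheAir

theorem mainTheorem9 {N : ℕ} (S : OverTheAir.System N)
    {Ω : Type*} [MeasurableSpace Ω] (μ : Measure Ω) [IsProbabilityMeasure μ]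
    (I : OverTheAir.Inputs S μ)
    (hstep : S.StepSize) (hconn : S.JointlyConnected) (hreg : S.StepSizeRegular) :
    I.AlmostSureConsensus := by
  have hcons := I.ae_exists_tendsto_state hstep hconn hreg
  obtain ⟨L, -, hL⟩ := hconn
  obtain ⟨i₀⟩ := (hL 0).nonempty
  obtain ⟨xstar, hmeas, hlim⟩ := measurable_limit_of_tendsto_metrizable_ae
    (fun k => (I.measurable_state_apply k i₀).aemeasurable) (hcons.mono fun ω ⟨c, hc⟩ => ⟨c, hc i₀⟩)
  refine ⟨xstar, hmeas, fun i => ?_⟩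
  filter_upwards [hcons, hlim] with ω ⟨c, hc⟩ hω
  rw [← tendsto_nhds_unique (hc i₀) hω]
  exact hc i
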